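/- Let $N\in\mathbf N$, $\mathbf T^N=\mathbf R^N/\mathbf Z^N$, let $\sigma:\mathbf T^N\to(0,\infty)$ be continuous, and let $m:[0,\infty)\to(0,1)$ be Lipschitz continuous and strictly increasing with $m(r)\to1$ as $r\to\infty$. Put $H(x,p)=\sigma(x)m(|p|)$ and $\underline\sigma=\inf_{\mathbf T^N}\sigma$. For a continuous Hamiltonian $F:\mathbf T^N\times\mathbf R^N\to\mathbf R$ and $P\in\mathbf R^N$, a solution of the cell problem $F(x,Du+P)=a$ in $\mathbf T^N$ is a pair $(u,a)$ of a constant $a\in\mathbf R$ and a Lipschitz continuous $u:\mathbf T^N\to\mathbf R$ that is a viscosity solution, i.e. for every $\phi\in C^1(\mathbf T^N)$ one has $F(\hat x,D\phi(\hat x)+P)\le a$ at each maximum point $\hat x$ of $u-\phi$ on $\mathbf T^N$, and $F(\hat x,D\phi(\hat x)+P)\ge a$ at each minimum point $\hat x$ of $u-\phi$. If exactly one $a$ admits a solution, it is called the critical value of the cell problem for $F$ at $P$. If this value exists for every $P$, it defines the effective Hamiltonian $\bar F(P)$ of $F$. Let $\mathcal D$ be the set of $P\in\mathbf R^N$ for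 which the cell problem $\sigma(x)m(|Du+P|)=a$ has a solution $(u,a)$. A sequence of functions $H_n:\mathbf T^N\times\mathbf R^N\to\mathbf R$ is called admissible if each $H_n$ is continuous and coercive, i.e. $\lim_{r\to\infty}\inf\{H_n(x,p): x\in\mathbf T^N,\ |p|\ge r\}=+\infty$, and $$\liminf_{n\to\infty}\inf_{\mathbf T^N\times\overline{B(0,R)}}(H-H_n)\ge0\ \text{ for all }R>0,\qquad \limsup_{n\to\infty}\sup_{\mathbf T^N\times\mathbf R^N}(H-H_n)\le0 .$$ A generalized effective Hamiltonian of $H$ is a function $\bar H_\infty:\mathbf R^N\to\mathbf R$ such that for every admissible sequence $(H_n)$, with effective Hamiltonians $\bar H_n$, $$\liminf_{n\to\infty}\inf_{\overline{B(0,R)}}(\bar H_\infty-\bar H_n)\ge0\ \text{ for all }R>0,\qquad \limsup_{n\to\infty}\sup_{\mathbf R^N}(\bar H_\infty-\bar H_n)\le0 .$$ Then there is exactly one generalized effective Hamiltonian $\bar H_\infty$ of $H$, and $$\mathcal D=\{P\in\mathbf R^N:\ \bar H_\infty(P)<\underline\sigma\}.$$ Moreover, for every $P\in\mathcal D$ the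 critical value of the cell problem for $H$ at $P$ exists and equals $\bar H_\infty(P)$. -/

import Mathlib

open Filter Topology
open scoped NNReal

namespace CellProblem

/-- Euclidean space of dimension `N`. -/
abbrev E (N : ℕ) : Type := EuclideanSpace ℝ (Fin N)

/-- `f` is periodic under integer translations, i.e. it is a function on the torus
(functions on the torus are regarded as periodic functions on Euclidean space). -/
def ZPeriodic {N : ℕ} {α : Type*} (f : E N → α) : Prop :=
  ∀ (x : E N) (z : Fin N → ℤ), f (x + WithLp.toLp 2 (fun i => (z i : ℝ))) = f x

/-- The superdifferential `D⁺u(x)`: gradients at `x` of the `C¹` test functions `φ` on the torus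
for which `u - φ` attains its maximum at `x`. -/
def superdifferential {N : ℕ} (u : E N → ℝ) (x : E N) : Set (E N) :=
  {p | ∃ φ : E N → ℝ, ZPeriodic φ ∧ ContDiff ℝ 1 φ ∧
    (∀ y, u y - φ y ≤ u x - φ x) ∧ gradient φ x = p}

/-- The subdifferential `D⁻u(x)`: gradients at `x` of the `C¹` test functions `φ` on the torus
for which `u - φ` attains its minimum at `x`. -/
def subdifferential {N : ℕ} (u : E N → ℝ) (x : E N) : Set (E N) :=
  {p | ∃ φ : E N → ℝ, ZPeriodic φ ∧ ContDiff ℝ 1 φ ∧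
    (∀ y, u x - φ x ≤ u y - φ y) ∧ gradient φ x = p}

/-- `u` is a viscosity subsolution of `F(x, Du(x)) = 0` on the torus. -/
def IsViscositySubsolution {N : ℕ} (F : E N → E N → ℝ) (u : E N → ℝ) : Prop :=
  ZPeriodic u ∧ Continuous u ∧ ∀ x, ∀ p ∈ superdifferential u x, F x p ≤ 0

/-- `u` is a viscosity supersolution of `F(x, Du(x)) = 0` on the torus. -/
def IsViscositySupersolution {N : ℕ} (F : E N → E N → ℝ) (u : E N → ℝ) : Prop :=
  ZPeriodic u ∧ Continuous u ∧ ∀ x, ∀ p ∈ subdifferential u x, 0 ≤ F x p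

/-- `u` is a viscosity solution of `F(x, Du(x)) = 0` on the torus. -/
def IsViscositySolution {N : ℕ} (F : E N → E N → ℝ) (u : E N → ℝ) : Prop :=
  IsViscositySubsolution F u ∧ IsViscositySupersolution F u

/-- The pair `(u, a)` solves the cell problem `H(x, Du(x) + P) = a` on the torus: `u` is a
Lipschitz continuous viscosity solution. -/
def IsCellSolution {N : ℕ} (H : E N → E N → ℝ) (P : E N) (u : E N → ℝ) (a : ℝ) : Prop :=
  (∃ K : ℝ≥0, LipschitzWith K u) ∧ IsViscositySolution (fun x p => H x (p + P) - a) u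

/-- `c` is the critical value of the cell problem for `H` at `P`: it is the unique constant
for which the cell problem has a solution. -/
def IsCriticalValue {N : ℕ} (H : E N → E N → ℝ) (P : E N) (c : ℝ) : Prop :=
  (∃ u, IsCellSolution H P u c) ∧ ∀ a, (∃ u, IsCellSolution H P u a) → a = c

/-- The solvability set: all `P` for which the cell problem has a solution `(u, c)`. -/
def solvabilitySet {N : ℕ} (H : E N → E N → ℝ) : Set (E N) :=
  {P | ∃ (u : E N → ℝ) (c : ℝ), IsCellSolution H P u c}

/-- `Hbar` is the effective Hamiltonian of `H`: the cell problem has a critical value for every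
`P`, and `Hbar P` is that value. -/
def IsEffectiveHamiltonian {N : ℕ} (H : E N → E N → ℝ) (Hbar : E N → ℝ) : Prop :=
  ∀ P, IsCriticalValue H P (Hbar P)

/-- Coercivity: `inf {H(x, p) | x, |p| ≥ r}` tends to `+∞` as `r → ∞`. -/
def Coercive {N : ℕ} (H : E N → E N → ℝ) : Prop :=
  ∀ C : ℝ, ∃ r : ℝ, ∀ x p, r ≤ ‖p‖ → C ≤ H x p

/-- `Hn` is a sequence of coercive continuous Hamiltonians on the torus which approximates `H`. -/
structure IsApproximation {N : ℕ} (H : E N → E N → ℝ) (Hn : ℕ → E N → E N → ℝ) : Prop where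
  periodic : ∀ n, ZPeriodic (Hn n)
  continuous : ∀ n, Continuous (fun q : E N × E N => Hn n q.1 q.2)
  coercive : ∀ n, Coercive (Hn n)
  /-- `liminf_n inf_{x, |p| ≤ R} (H - Hₙ) ≥ 0` for every `R > 0` -/
  liminf_nonneg : ∀ R > 0, ∀ ε > 0, ∀ᶠ n in atTop, ∀ x p, ‖p‖ ≤ R → -ε ≤ H x p - Hn n x p
  /-- `limsup_n sup_{x, p} (H - Hₙ) ≤ 0` -/
  limsup_nonpos : ∀ ε > 0, ∀ᶠ n in atTop, ∀ x p, H x p - Hn n x p ≤ ε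

/-- `G` is a generalized effective Hamiltonian of `H`: for every approximating sequence `Hₙ`,
with effective Hamiltonians `H̄ₙ`, one has `liminf_n inf_{|P| ≤ R} (G - H̄ₙ) ≥ 0` for every
`R > 0`, and `limsup_n sup_P (G - H̄ₙ) ≤ 0`. -/
def IsGeneralizedEffectiveHamiltonian {N : ℕ} (H : E N → E N → ℝ) (G : E N → ℝ) : Prop :=
  ∀ (Hn : ℕ → E N → E N → ℝ) (Hbar : ℕ → E N → ℝ),
    IsApproximation H Hn → (∀ n, IsEffectiveHamiltonian (Hn n) (Hbar n)) →
      (∀ R > 0, ∀ ε > 0, ∀ᶠ n in atTop, ∀ P, ‖P‖ ≤ R → -ε ≤ G P - Hbar n P) ∧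
      (∀ ε > 0, ∀ᶠ n in atTop, ∀ P, G P - Hbar n P ≤ ε)

/-- The Hamiltonian `H(x, p) = σ(x) m(|p|)`. -/
noncomputable def hamiltonian {N : ℕ} (σ : E N → ℝ) (m : ℝ≥0 → ℝ) (x p : E N) : ℝ := σ x * m ‖p‖₊

end CellProblem

/-! The generalized effective Hamiltonian is `effectiveInf H P`, the infimum of the levels `a` at
which H(x, Du + P) ≤ a has a Lipschitz subsolution. By `comparison`, the level of a cell solution is
at most every subsolution level, hence equals this infimum. Only the subsolution must be Lipschitz
there, and H need not be coercive, so this gives uniqueness of critical values for H as well as for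
its approximations. `effectiveInf H` has the defining property because Lipschitz subsolutions pass
between H and Hₙ at the cost of a small change of level
(`isGeneralizedEffectiveHamiltonian_effectiveInf`). It is the only such function because one
admissible sequence with effective Hamiltonians, H + (|p| - n)₊, already forces the limit at each P;
its cell problems are solved by Perron's method and vanishing discount (`exists_isCellSolution`).
For the solvability set: a Lipschitz u keeps m(|Du + P|) away from 1, so near a minimum of σ the
level must lie below inf σ (`IsCellSolution.lt_iInf`). Conversely, if the limit level is below inf
σ, then for some n the added term is invisible at the level of the approximate cell problem, whose
solution also solves the problem for H (`IsCellSolution.of_coerciveApprox`). -/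

namespace CellProblem

variable {N : ℕ}

/-! ### Periodic functions and compactness of the torus. -/

/-- The integer vector `z`, as a point of Euclidean space. -/
noncomputable def intVec (z : Fin N → ℤ) : E N := WithLp.toLp 2 fun i => (z i : ℝ)

lemma intVec_apply (z : Fin N → ℤ) (i : Fin N) : intVec z i = z i := rfl

lemma ZPeriodic.add_intVec {α : Type*} {f : E N → α} (hf : ZPeriodic f) (x : E N)
    (z : Fin N → ℤ) : f (x + intVec z) = f x := hf x z

/-- The fundamental cube `[-1/2, 1/2]^N`. -/
def cube (N : ℕ) : Set (E N) := {x | ∀ i, |x i| ≤ 1 / 2}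

lemma isCompact_cube : IsCompact (cube N) := by
  have h : IsCompact (Set.univ.pi fun _ : Fin N => Set.Icc (-(1 / 2 : ℝ)) (1 / 2)) :=
    isCompact_univ_pi fun _ => isCompact_Icc
  convert h.image (PiLp.continuous_toLp 2 (fun _ : Fin N => ℝ)) using 1
  ext x
  simp only [cube, Set.mem_ofPred_eq, Set.mem_image, Set.mem_univ_pi, Set.mem_Icc, ← abs_le]
  constructor
  · intro hx
    exact ⟨x.ofLp, hx, rfl⟩
  · rintro ⟨y, hy, rfl⟩
    exact hy

lemma zero_mem_cube : (0 : E N) ∈ cube N := fun i => by simp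

lemma exists_add_intVec_mem_cube (x : E N) : ∃ z : Fin N → ℤ, x + intVec z ∈ cube N := by
  refine ⟨fun i => -round (x i), fun i => ?_⟩
  have := abs_sub_round (x i)
  simpa [intVec_apply, sub_eq_add_neg] using this

/-- A continuous function on the torus attains its maximum. -/
lemma ZPeriodic.exists_max {f : E N → ℝ} (hf : ZPeriodic f) (hc : Continuous f) :
    ∃ x ∈ cube N, ∀ y, f y ≤ f x := by
  obtain ⟨x, hx, h⟩ := isCompact_cube.exists_isMaxOn ⟨0, zero_mem_cube⟩ hc.continuousOn
  refine ⟨x, hx, fun y => ?_⟩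
  obtain ⟨z, hz⟩ := exists_add_intVec_mem_cube y
  rw [← hf.add_intVec y z]
  exact h hz

lemma ZPeriodic.neg {f : E N → ℝ} (hf : ZPeriodic f) : ZPeriodic (fun x => -f x) :=
  fun x z => by simp [hf x z]

lemma ZPeriodic.add {f g : E N → ℝ} (hf : ZPeriodic f) (hg : ZPeriodic g) :
    ZPeriodic (fun x => f x + g x) :=
  fun x z => by simp [hf x z, hg x z]

lemma ZPeriodic.sub {f g : E N → ℝ} (hf : ZPeriodic f) (hg : ZPeriodic g) :
    ZPeriodic (fun x => f x - g x) :=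
  fun x z => by simp [hf x z, hg x z]

lemma ZPeriodic.const_mul {f : E N → ℝ} (hf : ZPeriodic f) (c : ℝ) :
    ZPeriodic (fun x => c * f x) :=
  fun x z => by simp [hf x z]

lemma ZPeriodic.comp_sub_right {α : Type*} {f : E N → α} (hf : ZPeriodic f) (a : E N) :
    ZPeriodic (fun x => f (x - a)) := fun x z => by
  have := hf (x - a) z
  rwa [sub_add_eq_add_sub] at this

lemma ZPeriodic.comp_sub_left {α : Type*} {f : E N → α} (hf : ZPeriodic f) (a : E N) :
    ZPeriodic (fun x => f (a - x)) := fun x z => by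
  have := hf (a - (x + WithLp.toLp 2 fun i => (z i : ℝ))) z
  rw [sub_add_eq_sub_sub, sub_add_cancel] at this
  simpa only [sub_add_eq_sub_sub] using this.symm

/-- A continuous function on the torus is bounded. -/
lemma ZPeriodic.exists_abs_le {f : E N → ℝ} (hf : ZPeriodic f) (hc : Continuous f) :
    ∃ M, 0 < M ∧ ∀ x, |f x| ≤ M := by
  obtain ⟨x, -, hx⟩ := ZPeriodic.exists_max (f := fun x => |f x|)
    (fun x z => by simp [hf x z]) hc.abs
  exact ⟨|f x| + 1, by positivity, fun y => (hx y).trans (by linarith)⟩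

/-- Along a fixed ultrafilter every sequence in a compact set converges, so no successive or
diagonal subsequences are needed. -/
lemma exists_ultrafilter_tendsto {ι X : Type*} [TopologicalSpace X] {s : Set X} (hs : IsCompact s)
    (l : Ultrafilter ι) {f : ι → X} (hf : ∀ᶠ k in l, f k ∈ s) :
    ∃ x ∈ s, Tendsto f l (𝓝 x) :=
  hs.ultrafilter_le_nhds (l.map f) (le_principal_iff.2 hf)

/-! ### The periodic substitute for the squared distance. -/

/-- A smooth penalty function on the torus, vanishing exactly at the lattice points. -/
noncomputable def pen (x : E N) : ℝ := ∑ i, (1 - Real.cos (2 * Real.pi * x i))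

/-- The gradient of `pen`. -/
noncomputable def penGrad (x : E N) : E N :=
  WithLp.toLp 2 fun i => 2 * Real.pi * Real.sin (2 * Real.pi * x i)

lemma pen_periodic : ZPeriodic (pen (N := N)) := by
  intro x z
  unfold pen
  refine Finset.sum_congr rfl fun i _ => ?_
  have : 2 * Real.pi * (x + intVec z) i = 2 * Real.pi * x i + z i * (2 * Real.pi) := by
    simp only [PiLp.add_apply, intVec_apply]; ring
  rw [show (x + WithLp.toLp 2 fun i => (z i : ℝ)) = x + intVec z from rfl, this,
    Real.cos_add_int_mul_two_pi]

lemma pen_nonneg (x : E N) : 0 ≤ pen x :=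
  Finset.sum_nonneg fun i _ => by linarith [Real.cos_le_one (2 * Real.pi * x i)]

lemma pen_zero : pen (0 : E N) = 0 := by simp [pen]

lemma pen_neg (x : E N) : pen (-x) = pen x := by simp [pen]

lemma penGrad_neg (x : E N) : penGrad (-x) = -penGrad x := by
  ext i; simp [penGrad]

lemma penGrad_zero : penGrad (0 : E N) = 0 := by ext i; simp [penGrad]

lemma contDiff_pen : ContDiff ℝ 1 (pen (N := N)) := by
  unfold pen; fun_prop

lemma continuous_penGrad : Continuous (penGrad (N := N)) := by
  unfold penGrad; fun_prop

lemma exists_intVec_of_pen_eq_zero {x : E N} (h : pen x = 0) : ∃ z, x = intVec z := by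
  have h1 := (Finset.sum_eq_zero_iff_of_nonneg
    (fun i _ => by linarith [Real.cos_le_one (2 * Real.pi * x i)])).1 h
  have h2 : ∀ i, ∃ n : ℤ, x i = n := by
    intro i
    have h3 : Real.cos (2 * Real.pi * x i) = 1 := by linarith [h1 i (Finset.mem_univ i)]
    obtain ⟨n, hn⟩ := (Real.cos_eq_one_iff _).1 h3
    refine ⟨n, ?_⟩
    have := Real.pi_pos
    nlinarith
  choose z hz using h2
  exact ⟨z, by ext i; exact hz i⟩

lemma ZPeriodic.eq_of_pen_eq_zero {α : Type*} {f : E N → α} (hf : ZPeriodic f) {x y : E N}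
    (h : pen (x - y) = 0) : f x = f y := by
  obtain ⟨z, hz⟩ := exists_intVec_of_pen_eq_zero h
  rw [← hf.add_intVec y z, ← hz]; simp

lemma penGrad_periodic : ZPeriodic (penGrad (N := N)) := by
  intro x z
  ext i
  have : 2 * Real.pi * (x + intVec z) i = 2 * Real.pi * x i + z i * (2 * Real.pi) := by
    simp only [PiLp.add_apply, intVec_apply]; ring
  simp only [penGrad]
  rw [show (x + WithLp.toLp 2 fun i => (z i : ℝ)) = x + intVec z from rfl, this,
    Real.sin_add_int_mul_two_pi]

lemma penGrad_eq_zero {x : E N} (h : pen x = 0) : penGrad x = 0 := by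
  rw [← penGrad_zero (N := N)]
  exact penGrad_periodic.eq_of_pen_eq_zero (by simpa using h)

lemma hasGradientAt_pen (x : E N) : HasGradientAt pen (penGrad x) x := by
  rw [hasGradientAt_iff_hasFDerivAt]
  have h1 : ∀ i : Fin N, HasFDerivAt (fun y : E N => y i)
      (EuclideanSpace.proj i : E N →L[ℝ] ℝ) x := fun i =>
    (EuclideanSpace.proj i : E N →L[ℝ] ℝ).hasFDerivAt
  have h2 := HasFDerivAt.fun_sum (u := Finset.univ) fun i _ =>
    (((h1 i).const_mul (2 * Real.pi)).cos).const_sub 1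
  refine h2.congr_fderiv ?_
  ext v
  simp only [penGrad, sum_apply, neg_apply, smul_apply, InnerProductSpace.toDual_apply_apply, PiLp.inner_apply,
    smul_eq_mul, RCLike.inner_apply, conj_trivial]
  refine Finset.sum_congr rfl fun i _ => ?_
  rw [show (EuclideanSpace.proj i : E N →L[ℝ] ℝ) v = v i from rfl]
  ring

lemma gradient_smul_pen_sub (k : ℝ) (a x : E N) :
    HasGradientAt (fun y => k * pen (y - a)) (k • penGrad (x - a)) x := by
  have h := (hasGradientAt_pen (x - a)).hasFDerivAt
  have h2 := (h.comp x ((hasFDerivAt_id x).sub_const a)).const_mul k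
  rw [hasGradientAt_iff_hasFDerivAt]
  refine h2.congr_fderiv ?_
  ext v
  simp

lemma contDiff_pen_sub (a : E N) : ContDiff ℝ 1 (fun y => pen (y - a)) :=
  contDiff_pen.comp (contDiff_id.sub contDiff_const)

/-! ### Calculus of semidifferentials. -/

lemma hasGradientAt_add {f g : E N → ℝ} {p q x : E N} (hf : HasGradientAt f p x)
    (hg : HasGradientAt g q x) : HasGradientAt (fun y => f y + g y) (p + q) x := by
  rw [hasGradientAt_iff_hasFDerivAt] at *
  rw [map_add]
  exact hf.add hg

lemma hasGradientAt_neg {f : E N → ℝ} {p x : E N} (hf : HasGradientAt f p x) :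
    HasGradientAt (fun y => -f y) (-p) x := by
  rw [hasGradientAt_iff_hasFDerivAt] at *
  rw [map_neg]
  exact hf.neg

lemma hasGradientAt_of_contDiff {f : E N → ℝ} (hf : ContDiff ℝ 1 f) (x : E N) :
    HasGradientAt f (gradient f x) x :=
  (hf.differentiable one_ne_zero x).hasGradientAt

lemma continuous_gradient {f : E N → ℝ} (hf : ContDiff ℝ 1 f) : Continuous (gradient f) :=
  (InnerProductSpace.toDual ℝ (E N)).symm.continuous.comp (hf.continuous_fderiv one_ne_zero)

lemma gradient_periodic {f : E N → ℝ} (hf : ZPeriodic f) : ZPeriodic (gradient f) := by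
  intro x z
  unfold gradient
  rw [← fderiv_comp_add_right]
  congr 2
  ext y
  exact hf y z

lemma mem_superdifferential {u φ : E N → ℝ} {x p : E N} (h₁ : ZPeriodic φ) (h₂ : ContDiff ℝ 1 φ)
    (h₃ : ∀ y, u y - φ y ≤ u x - φ x) (h₄ : HasGradientAt φ p x) :
    p ∈ superdifferential u x :=
  ⟨φ, h₁, h₂, h₃, h₄.gradient⟩

lemma mem_subdifferential_iff {u : E N → ℝ} {x p : E N} :
    p ∈ subdifferential u x ↔ -p ∈ superdifferential (fun y => -u y) x := by
  constructor
  · rintro ⟨φ, h₁, h₂, h₃, rfl⟩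
    exact mem_superdifferential h₁.neg h₂.neg (fun y => by linarith [h₃ y])
      (hasGradientAt_neg (hasGradientAt_of_contDiff h₂ x))
  · rintro ⟨φ, h₁, h₂, h₃, h₄⟩
    refine ⟨fun y => -φ y, h₁.neg, h₂.neg, fun y => by linarith [h₃ y], ?_⟩
    rw [(hasGradientAt_neg (hasGradientAt_of_contDiff h₂ x)).gradient, h₄, neg_neg]

lemma isViscositySupersolution_iff {F : E N → E N → ℝ} {u : E N → ℝ} :
    IsViscositySupersolution F u ↔
      IsViscositySubsolution (fun x p => -F x (-p)) (fun x => -u x) := by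
  constructor
  · rintro ⟨h₁, h₂, h₃⟩
    refine ⟨h₁.neg, h₂.neg, fun x p hp => ?_⟩
    have := h₃ x (-p) (mem_subdifferential_iff.2 (by simpa using hp))
    simpa using this
  · rintro ⟨h₁, h₂, h₃⟩
    refine ⟨by simpa using h₁.neg, h₂.neg.congr fun x => neg_neg (u x), fun x p hp => ?_⟩
    have := h₃ x (-p) (mem_subdifferential_iff.1 hp)
    simpa using this

/-- Superdifferentials of a Lipschitz function are bounded by its Lipschitz constant. -/
lemma norm_le_of_mem_superdifferential {u : E N → ℝ} {K : ℝ≥0} (hu : LipschitzWith K u)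
    {x p : E N} (hp : p ∈ superdifferential u x) : ‖p‖ ≤ K := by
  obtain ⟨φ, -, h₂, h₃, rfl⟩ := hp
  set p := gradient φ x
  rcases eq_or_ne p 0 with hp0 | hp0
  · simp [hp0]
  have hφ := (hasGradientAt_of_contDiff h₂ x).hasFDerivAt
  -- Along the ray x - t p the function φ falls at rate ‖p‖², while u falls at rate at most K ‖p‖;
  -- the maximum of u - φ at x forbids φ from falling faster than u.
  have hline : HasDerivAt (fun t : ℝ => x - t • p) (-p) 0 := by
    simpa using ((hasDerivAt_id (0 : ℝ)).smul_const p).const_sub x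
  have hcomp : HasDerivAt (fun t : ℝ => φ (x - t • p)) (-(‖p‖ ^ 2)) 0 := by
    have h := HasFDerivAt.comp_hasDerivAt (0 : ℝ) (l := φ) (by rwa [zero_smul, sub_zero]) hline
    rwa [InnerProductSpace.toDual_apply_apply, inner_neg_right, real_inner_self_eq_norm_sq] at h
  have hlim := hcomp.tendsto_slope_zero_right
  have key : -(K * ‖p‖) ≤ -(‖p‖ ^ 2) := by
    refine ge_of_tendsto hlim ?_
    filter_upwards [self_mem_nhdsWithin] with t ht
    have ht : (0 : ℝ) < t := ht
    have h1 := h₃ (x - t • p)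
    have h2 := hu.dist_le_mul (x - t • p) x
    rw [Real.dist_eq, dist_eq_norm] at h2
    have h3 : ‖x - t • p - x‖ = t * ‖p‖ := by
      rw [sub_sub_cancel_left, norm_neg, norm_smul, Real.norm_of_nonneg ht.le]
    rw [h3] at h2
    have h4 := (abs_le.1 h2).1
    simp only [zero_add, zero_smul, sub_zero, smul_eq_mul]
    rw [inv_mul_eq_div, le_div_iff₀ ht]
    nlinarith
  have : 0 < ‖p‖ := norm_pos_iff.2 hp0
  nlinarith

lemma lipschitzWith_neg {u : E N → ℝ} {K : ℝ≥0} (hu : LipschitzWith K u) :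
    LipschitzWith K (fun x => -u x) := hu.neg

lemma norm_le_of_mem_subdifferential {u : E N → ℝ} {K : ℝ≥0} (hu : LipschitzWith K u)
    {x p : E N} (hp : p ∈ subdifferential u x) : ‖p‖ ≤ K := by
  have := norm_le_of_mem_superdifferential (lipschitzWith_neg hu)
    (mem_subdifferential_iff.1 hp)
  rwa [norm_neg] at this

/-- Every continuous function on the torus has a maximum point, where `0` is a supergradient. -/
lemma exists_zero_mem_superdifferential {u : E N → ℝ} (hp : ZPeriodic u) (hc : Continuous u) :
    ∃ x, (0 : E N) ∈ superdifferential u x ∧ ∀ y, u y ≤ u x := by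
  obtain ⟨x, -, hx⟩ := hp.exists_max hc
  exact ⟨x, mem_superdifferential (φ := fun _ => 0) (fun _ _ => rfl) contDiff_const
    (fun y => by simpa using hx y) (hasGradientAt_const x 0), hx⟩

/-! ### Comparison and stability. -/

/-- Comparison: a Lipschitz subsolution at level `a` and a supersolution at level `b` of the same
equation force `b ≤ a`. -/
lemma comparison {H : E N → E N → ℝ} (hHp : ZPeriodic H)
    (hHc : Continuous fun q : E N × E N => H q.1 q.2) {u v : E N → ℝ} {a b : ℝ} {K : ℝ≥0}
    (hK : LipschitzWith K u) (hu : IsViscositySubsolution (fun x p => H x p - a) u)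
    (hv : IsViscositySupersolution (fun x p => H x p - b) v) : b ≤ a := by
  obtain ⟨hup, huc, hu⟩ := hu
  obtain ⟨hvp, hvc, hv⟩ := hv
  -- Doubling of variables: the penalty k · pen (x - y) yields one vector `p k` that is a
  -- supergradient of u at `x k` and a subgradient of v at `y k`.
  have hmax : ∀ k : ℕ, ∃ x ∈ cube N, ∃ y ∈ cube N, ∀ x' y',
      u x' - v y' - k * pen (x' - y') ≤ u x - v y - k * pen (x - y) := by
    intro k
    have hc : Continuous fun q : E N × E N => u q.1 - v q.2 - k * pen (q.1 - q.2) := by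
      have := (contDiff_pen (N := N)).continuous
      fun_prop
    obtain ⟨⟨x, y⟩, hxy, h⟩ := (isCompact_cube.prod isCompact_cube).exists_isMaxOn
      ⟨(0, 0), zero_mem_cube, zero_mem_cube⟩ hc.continuousOn
    refine ⟨x, hxy.1, y, hxy.2, fun x' y' => ?_⟩
    obtain ⟨z, hz⟩ := exists_add_intVec_mem_cube x'
    obtain ⟨w, hw⟩ := exists_add_intVec_mem_cube y'
    have h1 := h (Set.mk_mem_prod hz hw)
    have h2 : pen (x' + intVec z - (y' + intVec w)) = pen (x' - y') := by
      rw [(pen_periodic.comp_sub_left _).add_intVec, (pen_periodic.comp_sub_right _).add_intVec]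
    simp only [Set.mem_ofPred_eq, h2, hup.add_intVec, hvp.add_intVec] at h1
    exact h1
  choose x hx y hy hxy using hmax
  set p : ℕ → E N := fun k => (k : ℝ) • penGrad (x k - y k) with hp
  have hpu : ∀ k, p k ∈ superdifferential u (x k) := fun k =>
    mem_superdifferential (φ := fun x' => k * pen (x' - y k))
      ((pen_periodic.comp_sub_right _).const_mul _) (contDiff_const.mul (contDiff_pen_sub _))
      (fun x' => by linarith [hxy k x' (y k)]) (gradient_smul_pen_sub _ _ _)
  have hpv : ∀ k, p k ∈ subdifferential v (y k) := fun k => by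
    refine mem_subdifferential_iff.2 (mem_superdifferential (φ := fun y' => k * pen (y' - x k))
      ((pen_periodic.comp_sub_right _).const_mul _) (contDiff_const.mul (contDiff_pen_sub _))
      (fun y' => ?_) ?_)
    · have := hxy k (x k) y'
      rw [← pen_neg (x k - y'), ← pen_neg (x k - y k), neg_sub, neg_sub] at this
      linarith
    · have := gradient_smul_pen_sub (k : ℝ) (x k) (y k)
      rwa [← neg_sub (x k) (y k), penGrad_neg, smul_neg] at this
  -- The Lipschitz bound on u alone confines the common gradients to a compact set; continuity of H
  -- then suffices to pass to the limit.
  have hpK : ∀ k, p k ∈ Metric.closedBall (0 : E N) K := fun k => by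
    simpa using norm_le_of_mem_superdifferential hK (hpu k)
  let l : Ultrafilter ℕ := hyperfilter ℕ
  have hl : (l : Filter ℕ) ≤ atTop := Nat.hyperfilter_le_atTop
  obtain ⟨ξ, -, hξ⟩ := exists_ultrafilter_tendsto isCompact_cube l (Eventually.of_forall hx)
  obtain ⟨ζ, -, hζ⟩ := exists_ultrafilter_tendsto isCompact_cube l (Eventually.of_forall hy)
  obtain ⟨q, -, hq⟩ := exists_ultrafilter_tendsto (isCompact_closedBall (0 : E N) (K : ℝ)) l
    (Eventually.of_forall hpK)
  obtain ⟨Mu, -, hMu⟩ := hup.exists_abs_le huc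
  obtain ⟨Mv, -, hMv⟩ := hvp.exists_abs_le hvc
  -- Comparing the maximum with the pair (0, 0) bounds k · pen (`x k` - `y k`), so the two limits
  -- agree modulo the lattice.
  have hpen : pen (ξ - ζ) = 0 := by
    have h1 : Tendsto (fun k => pen (x k - y k)) l (𝓝 (pen (ξ - ζ))) :=
      ((contDiff_pen (N := N)).continuous.tendsto _).comp (hξ.sub hζ)
    have h2 : Tendsto (fun k : ℕ => (2 * Mu + 2 * Mv) / (k : ℝ)) l (𝓝 0) :=
      (tendsto_const_div_atTop_nhds_zero_nat _).mono_left hl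
    refine le_antisymm (le_of_tendsto_of_tendsto h1 h2 ?_) (pen_nonneg _)
    filter_upwards [hl (eventually_gt_atTop 0)] with k hk
    have hk : (0 : ℝ) < k := by exact_mod_cast hk
    rw [le_div_iff₀ hk]
    have h3 := hxy k 0 0
    rw [sub_zero, pen_zero] at h3
    have := abs_le.1 (hMu 0)
    have := abs_le.1 (hMu (x k))
    have := abs_le.1 (hMv 0)
    have := abs_le.1 (hMv (y k))
    nlinarith
  have hHξ : H ξ q ≤ a := by
    refine le_of_tendsto ((hHc.tendsto (ξ, q)).comp (hξ.prodMk_nhds hq))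
      (Eventually.of_forall fun k => ?_)
    have := hu _ _ (hpu k)
    simp only [Function.comp]
    linarith
  have hHζ : b ≤ H ζ q := by
    refine ge_of_tendsto ((hHc.tendsto (ζ, q)).comp (hζ.prodMk_nhds hq))
      (Eventually.of_forall fun k => ?_)
    have := hv _ _ (hpv k)
    simp only [Function.comp]
    linarith
  rw [hHp.eq_of_pen_eq_zero hpen] at hHξ
  exact hHζ.trans hHξ

/-- Stability of subsolutions under pointwise limits of equi-Lipschitz functions. -/
lemma IsViscositySubsolution.of_tendsto {ι : Type*} {l : Ultrafilter ι}
    {F : ι → E N → E N → ℝ} {G : E N → E N → ℝ} {u : ι → E N → ℝ} {v : E N → ℝ} {K : ℝ≥0}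
    (hK : ∀ k, LipschitzWith K (u k)) (hv : ZPeriodic v) (hGp : ZPeriodic G)
    (hu : ∀ k, IsViscositySubsolution (F k) (u k)) (hlim : ∀ x, Tendsto (fun k => u k x) l (𝓝 (v x)))
    (hF : ∀ (x : ι → E N) (p : ι → E N) (ξ q : E N), Tendsto x l (𝓝 ξ) → Tendsto p l (𝓝 q) →
      Tendsto (fun k => F k (x k) (p k)) l (𝓝 (G ξ q))) :
    LipschitzWith K v ∧ IsViscositySubsolution G v := by
  have hvK : LipschitzWith K v := by
    refine LipschitzWith.of_dist_le_mul fun x y => ?_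
    exact le_of_tendsto ((hlim x).dist (hlim y)) (Eventually.of_forall fun k =>
      (hK k).dist_le_mul x y)
  refine ⟨hvK, hv, hvK.continuous, ?_⟩
  rintro x₀ _ ⟨φ, hφp, hφ, hφmax, rfl⟩
  -- Adding the penalty to φ makes x₀ the only maximum point of the limit problem modulo the
  -- lattice, without changing the gradient at x₀. The maximum points for u k must therefore
  -- approach x₀ on the torus.
  have hmax : ∀ k, ∃ x ∈ cube N, ∀ y,
      u k y - (φ y + 1 * pen (y - x₀)) ≤ u k x - (φ x + 1 * pen (x - x₀)) := fun k =>
    ZPeriodic.exists_max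
      ((hu k).1.sub (hφp.add ((pen_periodic.comp_sub_right x₀).const_mul 1)))
      ((hu k).2.1.sub (hφ.continuous.add (continuous_const.mul (contDiff_pen_sub x₀).continuous)))
  choose x hx hxm using hmax
  obtain ⟨ξ, -, hξ⟩ := exists_ultrafilter_tendsto isCompact_cube l (Eventually.of_forall hx)
  have hux : Tendsto (fun k => u k (x k)) l (𝓝 (v ξ)) := by
    have h1 : Tendsto (fun k => u k (x k) - u k ξ) l (𝓝 0) := by
      refine squeeze_zero_norm (fun k => ?_) (a := fun k => K * dist (x k) ξ) ?_
      · rw [← dist_eq_norm]; exact (hK k).dist_le_mul _ _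
      · have := (tendsto_iff_dist_tendsto_zero.1 hξ).const_mul (K : ℝ)
        simpa using this
    simpa using h1.add (hlim ξ)
  have hpenlim : Tendsto (fun k => pen (x k - x₀)) l (𝓝 (pen (ξ - x₀))) :=
    ((contDiff_pen_sub x₀).continuous.tendsto ξ).comp hξ
  have hpen : pen (ξ - x₀) = 0 := by
    have h1 := hux.sub (((hφ.continuous.tendsto ξ).comp hξ).add (hpenlim.const_mul 1))
    have h2 := le_of_tendsto_of_tendsto (((hlim x₀).sub_const (φ x₀ + 1 * pen (x₀ - x₀)))) h1
      (Eventually.of_forall fun k => hxm k x₀)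
    rw [sub_self, pen_zero] at h2
    have := hφmax ξ
    have := pen_nonneg (ξ - x₀)
    linarith
  have hgrad : ∀ k, gradient φ (x k) + (1 : ℝ) • penGrad (x k - x₀) ∈
      superdifferential (u k) (x k) := fun k =>
    mem_superdifferential (hφp.add ((pen_periodic.comp_sub_right x₀).const_mul 1))
      (hφ.add (contDiff_const.mul (contDiff_pen_sub x₀))) (hxm k)
      (hasGradientAt_add (hasGradientAt_of_contDiff hφ _) (gradient_smul_pen_sub _ _ _))
  have hglim : Tendsto (fun k => gradient φ (x k) + (1 : ℝ) • penGrad (x k - x₀)) l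
      (𝓝 (gradient φ x₀)) := by
    have h1 := (((continuous_gradient hφ).tendsto ξ).comp hξ).add
      (((continuous_penGrad.tendsto _).comp (hξ.sub_const x₀)).const_smul (1 : ℝ))
    rw [penGrad_eq_zero hpen, smul_zero, add_zero,
      (gradient_periodic hφp).eq_of_pen_eq_zero hpen] at h1
    exact h1
  have := le_of_tendsto (hF _ _ _ _ hξ hglim)
    (Eventually.of_forall fun k => (hu k).2.2 _ _ (hgrad k))
  rwa [hGp.eq_of_pen_eq_zero hpen] at this

/-- Stability of supersolutions under pointwise limits of equi-Lipschitz functions. -/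
lemma IsViscositySupersolution.of_tendsto {ι : Type*} {l : Ultrafilter ι}
    {F : ι → E N → E N → ℝ} {G : E N → E N → ℝ} {u : ι → E N → ℝ} {v : E N → ℝ} {K : ℝ≥0}
    (hK : ∀ k, LipschitzWith K (u k)) (hv : ZPeriodic v) (hGp : ZPeriodic G)
    (hu : ∀ k, IsViscositySupersolution (F k) (u k))
    (hlim : ∀ x, Tendsto (fun k => u k x) l (𝓝 (v x)))
    (hF : ∀ (x : ι → E N) (p : ι → E N) (ξ q : E N), Tendsto x l (𝓝 ξ) → Tendsto p l (𝓝 q) →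
      Tendsto (fun k => F k (x k) (p k)) l (𝓝 (G ξ q))) :
    IsViscositySupersolution G v := by
  rw [isViscositySupersolution_iff]
  refine (IsViscositySubsolution.of_tendsto (l := l) (fun k => lipschitzWith_neg (hK k)) hv.neg
    (fun x z => by ext p; simp [hGp x z]) (fun k => isViscositySupersolution_iff.1 (hu k))
    (fun x => (hlim x).neg) fun x p ξ q hx hp => ?_).2
  exact (hF _ _ _ _ hx hp.neg).neg

/-- Subdifferentials are nonempty near any given point of the torus, in the sense of any continuous
function on the torus. -/
lemma exists_mem_subdifferential_lt {u f : E N → ℝ} (hup : ZPeriodic u) (huc : Continuous u)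
    (hfp : ZPeriodic f) (hfc : Continuous f) (x₀ : E N) {ε : ℝ} (hε : 0 < ε) :
    ∃ x p, p ∈ subdifferential u x ∧ f x < f x₀ + ε := by
  -- The subdifferential at x₀ itself may be empty. Touching u from below by translates of -k · pen
  -- (y - x₀) gives subgradients at points that approach x₀ on the torus as k grows.
  have hmax : ∀ k : ℕ, ∃ x ∈ cube N, ∀ y,
      -u y - (k : ℝ) * pen (y - x₀) ≤ -u x - (k : ℝ) * pen (x - x₀) := fun k =>
    ZPeriodic.exists_max
      (hup.neg.sub (((pen_periodic.comp_sub_right x₀).const_mul (k : ℝ))))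
      (huc.neg.sub (continuous_const.mul (contDiff_pen_sub x₀).continuous))
  choose x hx hxm using hmax
  let l : Ultrafilter ℕ := hyperfilter ℕ
  have hl : (l : Filter ℕ) ≤ atTop := Nat.hyperfilter_le_atTop
  obtain ⟨ξ, -, hξ⟩ := exists_ultrafilter_tendsto isCompact_cube l (Eventually.of_forall hx)
  obtain ⟨M, -, hM⟩ := hup.exists_abs_le huc
  have hpen : pen (ξ - x₀) = 0 := by
    have h1 : Tendsto (fun k => pen (x k - x₀)) l (𝓝 (pen (ξ - x₀))) :=
      ((contDiff_pen_sub x₀).continuous.tendsto ξ).comp hξ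
    have h2 : Tendsto (fun k : ℕ => (2 * M) / (k : ℝ)) l (𝓝 0) :=
      (tendsto_const_div_atTop_nhds_zero_nat _).mono_left hl
    refine le_antisymm (le_of_tendsto_of_tendsto h1 h2 ?_) (pen_nonneg _)
    filter_upwards [hl (eventually_gt_atTop 0)] with k hk
    have hk : (0 : ℝ) < k := by exact_mod_cast hk
    rw [le_div_iff₀ hk]
    have h3 := hxm k x₀
    rw [sub_self, pen_zero] at h3
    have := abs_le.1 (hM x₀)
    have := abs_le.1 (hM (x k))
    nlinarith
  have hlim : Tendsto (fun k => f (x k)) l (𝓝 (f x₀)) := by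
    rw [← hfp.eq_of_pen_eq_zero hpen]
    exact (hfc.tendsto ξ).comp hξ
  obtain ⟨k, hk⟩ := (hlim.eventually_lt_const (show f x₀ < f x₀ + ε by linarith)).exists
  refine ⟨x k, -((k : ℝ) • penGrad (x k - x₀)), mem_subdifferential_iff.2 ?_, hk⟩
  rw [neg_neg]
  exact mem_superdifferential ((pen_periodic.comp_sub_right x₀).const_mul (k : ℝ))
    (contDiff_const.mul (contDiff_pen_sub x₀)) (hxm k) (gradient_smul_pen_sub _ _ _)

lemma eq_of_isLocalMax_sub {f g : E N → ℝ} {x p q : E N} (hf : HasGradientAt f p x)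
    (hg : HasGradientAt g q x) (h : IsLocalMax (fun y => f y - g y) x) : p = q := by
  have h1 := hasGradientAt_add hf (hasGradientAt_neg hg)
  have h2 := h.hasFDerivAt_eq_zero (by simpa only [sub_eq_add_neg] using h1.hasFDerivAt)
  have h3 : p + -q = 0 := (InnerProductSpace.toDual ℝ (E N)).map_eq_zero_iff.1 h2
  rw [← sub_eq_add_neg] at h3
  exact sub_eq_zero.1 h3

/-! ### Nonperiodic test functions and the Lipschitz estimate. -/

lemma abs_sub_sin_le {θ : ℝ} (h : |θ| ≤ Real.pi) :
    |θ - Real.sin θ| ≤ Real.pi ^ 2 * (1 - Real.cos θ) := by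
  have h1 := Real.cos_le_one_sub_mul_cos_sq h
  have hπ := Real.pi_pos
  have h2 : 2 * θ ^ 2 ≤ Real.pi ^ 2 * (1 - Real.cos θ) := by
    have : 2 / Real.pi ^ 2 * θ ^ 2 ≤ 1 - Real.cos θ := by linarith
    calc 2 * θ ^ 2 = Real.pi ^ 2 * (2 / Real.pi ^ 2 * θ ^ 2) := by field_simp
      _ ≤ _ := by gcongr
  refine le_trans ?_ h2
  have key : ∀ t : ℝ, 0 < t → |t - Real.sin t| ≤ 2 * t ^ 2 := by
    intro t ht
    rw [abs_of_nonneg (by linarith [Real.sin_lt ht])]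
    rcases le_total t 1 with h | h
    · have := Real.sin_gt_sub_cube ht
      nlinarith [pow_pos ht 2]
    · nlinarith [Real.neg_one_le_sin t]
  rcases lt_trichotomy θ 0 with h0 | h0 | h0
  · have := key (-θ) (by linarith)
    rw [Real.sin_neg, neg_sq, ← neg_sub', abs_neg] at this
    exact this
  · simp [h0]
  · exact key θ h0

/-- A smooth periodic map which agrees with the identity to first order at the origin. -/
noncomputable def wrap (t : E N) : E N :=
  WithLp.toLp 2 fun i => Real.sin (2 * Real.pi * t i) / (2 * Real.pi)

lemma wrap_periodic : ZPeriodic (wrap (N := N)) := by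
  intro x z
  ext i
  have : 2 * Real.pi * (x + intVec z) i = 2 * Real.pi * x i + z i * (2 * Real.pi) := by
    simp only [PiLp.add_apply, intVec_apply]; ring
  simp only [wrap]
  rw [show (x + WithLp.toLp 2 fun i => (z i : ℝ)) = x + intVec z from rfl, this,
    Real.sin_add_int_mul_two_pi]

lemma wrap_zero : wrap (0 : E N) = 0 := by ext i; simp [wrap]

lemma contDiff_wrap : ContDiff ℝ 1 (wrap (N := N)) := by
  unfold wrap; fun_prop

lemma norm_le_sum_abs (x : E N) : ‖x‖ ≤ ∑ i, |x i| := by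
  rw [EuclideanSpace.norm_eq]
  refine Real.sqrt_le_iff.2 ⟨Finset.sum_nonneg fun i _ => abs_nonneg _, ?_⟩
  simpa using Finset.sum_sq_le_sq_sum_of_nonneg (s := Finset.univ) (f := fun i => |x i|)
    fun i _ => abs_nonneg _

/-- Since `wrap` agrees with the identity to first order, its error is dominated by `pen`, which is
quadratic at the origin. The penalty can thus absorb the error made by periodizing a Lipschitz test
function. -/
lemma norm_sub_wrap_le {t : E N} (ht : t ∈ cube N) : ‖t - wrap t‖ ≤ Real.pi / 2 * pen t := by
  refine (norm_le_sum_abs _).trans ?_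
  rw [pen, Finset.mul_sum]
  refine Finset.sum_le_sum fun i _ => ?_
  have hπ := Real.pi_pos
  have h1 : |2 * Real.pi * t i| ≤ Real.pi := by
    rw [abs_mul, abs_of_pos (by positivity)]
    nlinarith [ht i]
  have h2 := abs_sub_sin_le h1
  have h3 : (t - wrap t) i =
      (2 * Real.pi * t i - Real.sin (2 * Real.pi * t i)) / (2 * Real.pi) := by
    simp only [wrap, PiLp.sub_apply]
    field_simp
  rw [h3, abs_div, abs_of_pos (show 0 < 2 * Real.pi by positivity), div_le_iff₀ (by positivity)]
  calc _ ≤ _ := h2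
    _ = _ := by ring

/-- Lipschitz test functions on Euclidean space which are not necessarily periodic may be used to
compute the superdifferential. -/
lemma mem_superdifferential_of_lipschitz {u ψ : E N → ℝ} {L : ℝ≥0} (hu : ZPeriodic u)
    (hψ : ContDiff ℝ 1 ψ) (hL : LipschitzWith L ψ) {x p : E N}
    (hmax : ∀ y, u y - ψ y ≤ u x - ψ x) (hp : HasGradientAt ψ p x) :
    p ∈ superdifferential u x := by
  -- Composing with `wrap` makes ψ periodic; the penalty term lifts the result above ψ on the cube
  -- around x, with equality at x. Hence φ still touches u from above there, and with the same
  -- gradient.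
  set φ : E N → ℝ := fun y => ψ (x + wrap (y - x)) + L * (Real.pi / 2) * pen (y - x) with hφ
  have hφp : ZPeriodic φ := by
    refine ZPeriodic.add ?_ ((pen_periodic.comp_sub_right x).const_mul _)
    intro y z
    have := wrap_periodic.comp_sub_right x y z
    simp only at this
    simp only [this]
  have hφd : ContDiff ℝ 1 φ :=
    (hψ.comp (contDiff_const.add (contDiff_wrap.comp (contDiff_id.sub contDiff_const)))).add
      (contDiff_const.mul (contDiff_pen_sub x))
  have hφx : φ x = ψ x := by simp [hφ, wrap_zero, pen_zero]
  have hle : ∀ y, y - x ∈ cube N → ψ y ≤ φ y := by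
    intro y hy
    have h1 := hL.dist_le_mul y (x + wrap (y - x))
    have h2 : dist y (x + wrap (y - x)) ≤ Real.pi / 2 * pen (y - x) := by
      rw [dist_eq_norm, ← sub_sub]
      exact norm_sub_wrap_le hy
    have h3 : ψ y - ψ (x + wrap (y - x)) ≤ L * (Real.pi / 2 * pen (y - x)) :=
      (le_abs_self _).trans (h1.trans (by gcongr))
    simp only [hφ]
    linarith
  refine mem_superdifferential hφp hφd (fun y => ?_) ?_
  · obtain ⟨z, hz⟩ := exists_add_intVec_mem_cube (y - x)
    rw [← hu.add_intVec y z, ← hφp.add_intVec y z, hφx]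
    have := hle (y + intVec z) (by convert hz using 1; abel)
    have := hmax (y + intVec z)
    linarith
  · have h := hasGradientAt_of_contDiff hφd x
    rwa [← eq_of_isLocalMax_sub hp h] at h
    filter_upwards [Metric.closedBall_mem_nhds x (show (0 : ℝ) < 1 / 2 by norm_num)] with y hy
    have := hle y fun i => ((PiLp.norm_apply_le (y - x) i).trans (by
      rwa [Metric.mem_closedBall, dist_eq_norm] at hy))
    rw [hφx]
    linarith

/-- Smooth approximation of the norm. -/
noncomputable def softNorm (η : ℝ) (x : E N) : ℝ := √(η ^ 2 + ‖x‖ ^ 2)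

lemma norm_le_softNorm (η : ℝ) (x : E N) : ‖x‖ ≤ softNorm η x :=
  Real.le_sqrt_of_sq_le (by nlinarith [sq_nonneg η])

lemma softNorm_le {η : ℝ} (hη : 0 ≤ η) (x : E N) : softNorm η x ≤ η + ‖x‖ :=
  Real.sqrt_le_iff.2 ⟨by positivity, by nlinarith [norm_nonneg x]⟩

lemma softNorm_pos {η : ℝ} (hη : 0 < η) (x : E N) : 0 < softNorm η x :=
  Real.sqrt_pos.2 (by positivity)

lemma contDiff_softNorm {η : ℝ} (hη : 0 < η) (y : E N) :
    ContDiff ℝ 1 fun x : E N => softNorm η (x - y) :=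
  (contDiff_const.add ((contDiff_id.sub contDiff_const).norm_sq ℝ)).sqrt
    fun x => ne_of_gt (by positivity)

lemma hasGradientAt_softNorm {η : ℝ} (hη : 0 < η) (y x : E N) :
    HasGradientAt (fun x : E N => softNorm η (x - y)) ((softNorm η (x - y))⁻¹ • (x - y)) x := by
  have h := ((((hasFDerivAt_id x).sub_const y).norm_sq).const_add (η ^ 2)).sqrt
    (ne_of_gt (by positivity))
  rw [hasGradientAt_iff_hasFDerivAt]
  refine h.congr_fderiv ?_
  ext v
  have : (softNorm η (x - y)) ≠ 0 := (softNorm_pos hη _).ne'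
  simp only [softNorm] at this ⊢
  simp
  field_simp

lemma lipschitzWith_softNorm (η : ℝ) (y : E N) :
    LipschitzWith 1 fun x : E N => softNorm η (x - y) := by
  refine LipschitzWith.of_le_add fun a b => ?_
  refine Real.sqrt_le_iff.2 ⟨add_nonneg (Real.sqrt_nonneg _) dist_nonneg, ?_⟩
  have h1 : ‖a - y‖ ≤ ‖b - y‖ + dist a b := by
    have := norm_add_le (a - b) (b - y)
    rw [sub_add_sub_cancel] at this
    rw [dist_eq_norm]; linarith
  have h2 : softNorm η (b - y) ^ 2 = η ^ 2 + ‖b - y‖ ^ 2 := Real.sq_sqrt (by positivity)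
  have h3 := norm_le_softNorm η (b - y)
  have h4 : 0 ≤ dist a b := dist_nonneg
  have h5 : ‖a - y‖ ^ 2 ≤ (‖b - y‖ + dist a b) ^ 2 := by gcongr
  nlinarith

/-- A continuous function on the torus whose superdifferentials are bounded by `K` is
`K`-Lipschitz. -/
lemma lipschitzWith_of_superdifferential {u : E N → ℝ} {K : ℝ≥0} (hu : ZPeriodic u)
    (hc : Continuous u) (h : ∀ x, ∀ p ∈ superdifferential u x, ‖p‖ ≤ K) : LipschitzWith K u := by
  have key : ∀ C : ℝ≥0, K < C → ∀ x y, u x ≤ u y + C * dist x y := by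
    intro C hKC x y
    obtain ⟨M, -, hM⟩ := hu.exists_abs_le hc
    have hCpos : (0 : ℝ) < C := lt_of_le_of_lt K.2 (by exact_mod_cast hKC)
    have hKC' : (K : ℝ) < C := by exact_mod_cast hKC
    have hsmall : ∀ ε > 0, u x ≤ u y + C * dist x y + (1 + C) * ε := by
      intro ε hε
      obtain ⟨δ, hδ, hδε⟩ := Metric.continuous_iff.1 hc y ε hε
      -- Since K < C, small η satisfies K (η + δ) < C δ. This will confine the touching point to the
      -- ball of radius δ about y.
      have hlim : Tendsto (fun η : ℝ => (K : ℝ) * (η + δ)) (𝓝[>] 0) (𝓝 ((K : ℝ) * (0 + δ))) :=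
        ((continuous_const.mul (continuous_id.add continuous_const)).tendsto 0).mono_left
          nhdsWithin_le_nhds
      obtain ⟨η, ⟨hη1, hη2⟩, hη⟩ := ((hlim.eventually_lt_const (show (K : ℝ) * (0 + δ) < C * δ by
        rw [zero_add]; gcongr)).and
        ((eventually_lt_nhds hε).filter_mono nhdsWithin_le_nhds)).and
        self_mem_nhdsWithin |>.exists
      have hη : 0 < η := hη
      -- A smoothed cone of slope C touches u from above at some ξ. Far from its vertex y the cone's
      -- gradient is longer than K, so ξ lies near y, and u ξ can be replaced by u y up to ε.
      set ψ : E N → ℝ := fun z => C * softNorm η (z - y) with hψ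
      have hψd : ContDiff ℝ 1 ψ := contDiff_const.mul (contDiff_softNorm hη y)
      have hψL : LipschitzWith C ψ := by
        refine LipschitzWith.of_dist_le_mul fun a b => ?_
        have := (lipschitzWith_softNorm η y).dist_le_mul a b
        simp only [NNReal.coe_one, one_mul, Real.dist_eq] at this
        rw [Real.dist_eq, ← mul_sub, abs_mul, abs_of_pos hCpos]
        gcongr
      obtain ⟨ξ, hξ⟩ := (hψd.continuous.sub hc).exists_forall_le (by
        have h1 : Tendsto (fun z : E N => C * ‖z‖ + (-(C * ‖y‖) - M)) (cocompact _) atTop :=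
          tendsto_atTop_add_const_right _ _
            ((tendsto_norm_cocompact_atTop (E := E N)).const_mul_atTop hCpos)
        refine tendsto_atTop_mono (fun z => ?_) h1
        have h2 := norm_le_softNorm η (z - y)
        have h3 := norm_sub_norm_le z y
        have h4 := (abs_le.1 (hM z)).2
        have : (C : ℝ) * (‖z‖ - ‖y‖) ≤ C * softNorm η (z - y) := by gcongr; linarith
        simp only [hψ, Pi.sub_apply]
        linarith)
      simp only [Pi.sub_apply] at hξ
      have hgrad : HasGradientAt ψ ((C : ℝ) • (softNorm η (ξ - y))⁻¹ • (ξ - y)) ξ := by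
        have h1 := (hasGradientAt_softNorm hη y ξ).hasFDerivAt.const_mul (C : ℝ)
        rw [hasGradientAt_iff_hasFDerivAt]
        refine h1.congr_fderiv ?_
        ext v
        simp
      have hs := softNorm_pos hη (ξ - y)
      have hb := h ξ _ (mem_superdifferential_of_lipschitz hu hψd hψL
        (fun z => by linarith [hξ z]) hgrad)
      rw [norm_smul, norm_smul, norm_inv, Real.norm_of_nonneg hs.le, Real.norm_of_nonneg hCpos.le,
        inv_mul_eq_div, mul_div_assoc', div_le_iff₀ hs] at hb
      have hdist : dist ξ y < δ := by
        rw [dist_eq_norm]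
        by_contra hcon
        push Not at hcon
        have h1 : (K : ℝ) * softNorm η (ξ - y) ≤ K * (η + ‖ξ - y‖) := by
          gcongr; exact softNorm_le hη.le _
        nlinarith
      have h1 := (abs_lt.1 (hδε ξ hdist)).2
      have h2 := hξ x
      have h3 : (C : ℝ) * softNorm η (x - y) ≤ C * (η + dist x y) := by
        gcongr; rw [dist_eq_norm]; exact softNorm_le hη.le _
      have h4 : 0 ≤ ψ ξ := by positivity
      have h5 : (C : ℝ) * η ≤ C * ε := by gcongr
      simp only [hψ] at h2 h4
      nlinarith
    refine le_of_forall_pos_le_add fun ε hε => ?_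
    have := hsmall (ε / (1 + C)) (by positivity)
    rwa [mul_div_cancel₀ _ (by positivity)] at this
  refine LipschitzWith.of_le_add_mul K fun x y => ?_
  have hlim : Tendsto (fun C : ℝ≥0 => u y + C * dist x y) (𝓝[>] K) (𝓝 (u y + K * dist x y)) :=
    ((continuous_const.add (NNReal.continuous_coe.mul continuous_const)).tendsto K).mono_left
      nhdsWithin_le_nhds
  exact ge_of_tendsto hlim (by
    filter_upwards [self_mem_nhdsWithin] with C hC using key C hC x y)

/-- Small values of `pen` describe neighbourhoods on the torus: by compactness `pen (y - x₀)` has a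
positive minimum on the set Q ≥ c. -/
lemma exists_forall_lt_of_pen_lt {Q : E N → ℝ} (hQp : ZPeriodic Q) (hQ : Continuous Q) {x₀ : E N}
    {c : ℝ} (h : Q x₀ < c) : ∃ δ > 0, ∀ y, pen (y - x₀) < δ → Q y < c := by
  have hcomp : IsCompact (cube N ∩ {y | c ≤ Q y}) :=
    isCompact_cube.inter_right (isClosed_le continuous_const hQ)
  have hred : ∀ δ, (∀ y ∈ cube N ∩ {y | c ≤ Q y}, δ ≤ pen (y - x₀)) →
      ∀ y, pen (y - x₀) < δ → Q y < c := by
    intro δ hδ y hy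
    by_contra! hcon
    obtain ⟨z, hz⟩ := exists_add_intVec_mem_cube y
    have := hδ (y + intVec z) ⟨hz, by simpa [hQp.add_intVec] using hcon⟩
    rw [(pen_periodic.comp_sub_right x₀).add_intVec] at this
    linarith
  rcases (cube N ∩ {y | c ≤ Q y}).eq_empty_or_nonempty with he | hne
  · exact ⟨1, one_pos, hred 1 fun y hy => by simp [he] at hy⟩
  · obtain ⟨ξ, hξ, hmin⟩ := hcomp.exists_isMinOn hne (contDiff_pen_sub x₀).continuous.continuousOn
    refine ⟨pen (ξ - x₀), (pen_nonneg _).lt_of_ne' fun h0 => ?_, hred _ fun y hy => hmin hy⟩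
    have := hQp.eq_of_pen_eq_zero h0
    have h2 : c ≤ Q ξ := hξ.2
    linarith

/-! ### Perron's method for the discounted equation. -/

/-- The subsolutions of the discounted equation `lam * w + H(x, Dw) = 0` which are bounded below
by `-M / lam`. -/
def discountedSubsolutions (H : E N → E N → ℝ) (lam M : ℝ) : Set (E N → ℝ) :=
  {w | IsViscositySubsolution (fun x p => lam * w x + H x p) w ∧ ∀ x, -M ≤ lam * w x}

section Perron

variable {H : E N → E N → ℝ} {lam M : ℝ} {K : ℝ≥0}

lemma discountedSubsolutions_le (hM : ∀ x, |H x 0| ≤ M) {w : E N → ℝ}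
    (hw : w ∈ discountedSubsolutions H lam M) (hlam : 0 < lam) (x : E N) : lam * w x ≤ M := by
  obtain ⟨y, hy, hmax⟩ := exists_zero_mem_superdifferential hw.1.1 hw.1.2.1
  have h1 := hw.1.2.2 y 0 hy
  have h2 := (abs_le.1 (hM y)).1
  have h3 : lam * w x ≤ lam * w y := by gcongr; exact hmax x
  simp only at h1
  linarith

/-- The lower bound -M on lam · w turns the equation into H ≤ M on all supergradients. The resulting
constant K does not depend on `lam`. -/
lemma discountedSubsolutions_lipschitz (hK : ∀ x p, H x p ≤ M → ‖p‖ ≤ K) {w : E N → ℝ}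
    (hw : w ∈ discountedSubsolutions H lam M) : LipschitzWith K w :=
  lipschitzWith_of_superdifferential hw.1.1 hw.1.2.1 fun x p hp => hK x p (by
    have h1 := hw.1.2.2 x p hp
    have h2 := hw.2 x
    simp only at h1
    linarith)

lemma const_mem_discountedSubsolutions (hM : ∀ x, |H x 0| ≤ M) (hlam : 0 < lam) :
    (fun _ => -M / lam) ∈ discountedSubsolutions H lam M := by
  have h : lam * (-M / lam) = -M := mul_div_cancel₀ _ hlam.ne'
  refine ⟨⟨fun _ _ => rfl, continuous_const, fun x p hp => ?_⟩, fun x => h.ge⟩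
  have h0 := norm_le_of_mem_superdifferential
    (LipschitzWith.const (-M / lam)) hp
  rw [NNReal.coe_zero, norm_le_zero_iff] at h0
  subst h0
  simp only
  linarith [(abs_le.1 (hM x)).2]

/-- The pointwise supremum of the discounted subsolutions is attained at each point. -/
lemma exists_mem_discountedSubsolutions_eq_sSup (hHp : ZPeriodic H)
    (hHc : Continuous fun q : E N × E N => H q.1 q.2) (hM : ∀ x, |H x 0| ≤ M)
    (hK : ∀ x p, H x p ≤ M → ‖p‖ ≤ K) (hlam : 0 < lam) (x₀ : E N) :
    ∃ w ∈ discountedSubsolutions H lam M,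
      w x₀ = sSup ((fun w : E N → ℝ => w x₀) '' discountedSubsolutions H lam M) := by
  set S := discountedSubsolutions H lam M with hS
  have hbdd : BddAbove ((fun w : E N → ℝ => w x₀) '' S) := by
    refine ⟨M / lam, ?_⟩
    rintro _ ⟨w, hw, rfl⟩
    rw [le_div_iff₀' hlam]
    exact discountedSubsolutions_le hM hw hlam x₀
  have hne : ((fun w : E N → ℝ => w x₀) '' S).Nonempty :=
    ⟨_, _, const_mem_discountedSubsolutions hM hlam, rfl⟩
  obtain ⟨s, -, hs, hsmem⟩ := exists_seq_tendsto_sSup hne hbdd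
  choose w hw hws using hsmem
  let l : Ultrafilter ℕ := hyperfilter ℕ
  have hl : (l : Filter ℕ) ≤ atTop := Nat.hyperfilter_le_atTop
  have hlim : ∀ x, ∃ a ∈ Set.Icc (-M / lam) (M / lam), Tendsto (fun k => w k x) l (𝓝 a) := fun x =>
    exists_ultrafilter_tendsto isCompact_Icc l (Eventually.of_forall fun k =>
      ⟨by rw [div_le_iff₀' hlam]; exact (hw k).2 x,
        by rw [le_div_iff₀' hlam]; exact discountedSubsolutions_le hM (hw k) hlam x⟩)
  choose v hv hvlim using hlim
  have hvp : ZPeriodic v := fun x z => tendsto_nhds_unique (hvlim _)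
    ((hvlim x).congr fun k => ((hw k).1.1.add_intVec x z).symm)
  have hstab := IsViscositySubsolution.of_tendsto (l := l) (K := K)
    (F := fun k x p => lam * w k x + H x p) (G := fun x p => lam * v x + H x p)
    (fun k => discountedSubsolutions_lipschitz hK (hw k)) hvp
    (fun x z => by ext p; simp [hvp x z, hHp x z]) (fun k => (hw k).1) hvlim
    (fun x p ξ q hx hp => by
      refine Tendsto.add (Tendsto.const_mul _ ?_) ((hHc.tendsto (ξ, q)).comp (hx.prodMk_nhds hp))
      have h1 : Tendsto (fun k => w k (x k) - w k ξ) l (𝓝 0) := by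
        refine squeeze_zero_norm (fun k => ?_) (a := fun k => K * dist (x k) ξ) ?_
        · rw [← dist_eq_norm]
          exact (discountedSubsolutions_lipschitz hK (hw k)).dist_le_mul _ _
        · simpa using (tendsto_iff_dist_tendsto_zero.1 hx).const_mul (K : ℝ)
      simpa using h1.add (hvlim ξ))
  refine ⟨v, ⟨hstab.2, fun x => ?_⟩, ?_⟩
  · have := (hv x).1
    rwa [div_le_iff₀' hlam] at this
  · exact tendsto_nhds_unique (hvlim x₀) ((hs.mono_left hl).congr fun k => (hws k).symm)

/-- The maximum of a discounted subsolution with a `C¹` function which is a strict subsolution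
wherever it lies above is a discounted subsolution. -/
lemma max_mem_discountedSubsolutions {v ψ : E N → ℝ}
    (hv : v ∈ discountedSubsolutions H lam M) (hlam : 0 < lam) (hψp : ZPeriodic ψ)
    (hψ : ContDiff ℝ 1 ψ) (h : ∀ x, v x < ψ x → lam * ψ x + H x (gradient ψ x) ≤ 0) :
    (fun x => max (v x) (ψ x)) ∈ discountedSubsolutions H lam M := by
  refine ⟨⟨fun x z => by simp only [hv.1.1 x z, hψp x z], hv.1.2.1.max hψ.continuous, ?_⟩,
    fun x => (hv.2 x).trans (by gcongr; exact le_max_left _ _)⟩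
  rintro x _ ⟨χ, hχp, hχ, hmax, rfl⟩
  rcases le_or_gt (ψ x) (v x) with hx | hx
  · simp only [max_eq_left hx] at hmax ⊢
    refine hv.1.2.2 x _ ⟨χ, hχp, hχ, fun y => ?_, rfl⟩
    linarith [hmax y, le_max_left (v y) (ψ y)]
  · simp only [max_eq_right hx.le] at hmax ⊢
    have hloc : IsLocalMax (fun y => ψ y - χ y) x := Eventually.of_forall fun y => by
      linarith [hmax y, le_max_right (v y) (ψ y)]
    rw [← eq_of_isLocalMax_sub (hasGradientAt_of_contDiff hψ x)
      (hasGradientAt_of_contDiff hχ x) hloc]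
    exact h x hx

/-- Perron's method for the discounted equation. -/
lemma exists_discounted_solution (hHp : ZPeriodic H)
    (hHc : Continuous fun q : E N × E N => H q.1 q.2) (hM : ∀ x, |H x 0| ≤ M)
    (hK : ∀ x p, H x p ≤ M → ‖p‖ ≤ K) (hlam : 0 < lam) :
    ∃ v : E N → ℝ, LipschitzWith K v ∧ (∀ x, |lam * v x| ≤ M) ∧
      IsViscositySolution (fun x p => lam * v x + H x p) v := by
  set v : E N → ℝ := fun x =>
    sSup ((fun w : E N → ℝ => w x) '' discountedSubsolutions H lam M) with hvdef
  have hle : ∀ w ∈ discountedSubsolutions H lam M, ∀ x, w x ≤ v x := fun w hw x => by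
    refine le_csSup ⟨M / lam, ?_⟩ ⟨w, hw, rfl⟩
    rintro _ ⟨w, hw, rfl⟩
    rw [le_div_iff₀' hlam]
    exact discountedSubsolutions_le hM hw hlam x
  have hatt := exists_mem_discountedSubsolutions_eq_sSup hHp hHc hM hK hlam
  have hvp : ZPeriodic v := fun x z => by
    simp only [hvdef]
    congr 1
    exact Set.image_congr fun w hw => hw.1.1 x z
  have hvK : LipschitzWith K v := by
    refine LipschitzWith.of_le_add_mul K fun x y => ?_
    obtain ⟨w, hw, hwx⟩ := hatt x
    have h1 := (le_abs_self _).trans ((discountedSubsolutions_lipschitz hK hw).dist_le_mul x y)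
    have h2 := hle w hw y
    simp only [hvdef] at h2 ⊢
    rw [← hwx]
    linarith
  have hvS : v ∈ discountedSubsolutions H lam M := by
    refine ⟨⟨hvp, hvK.continuous, ?_⟩, fun x => ?_⟩
    · rintro x _ ⟨φ, hφp, hφ, hmax, rfl⟩
      -- The supremum is attained at x by some w ≤ v, so a function touching v from above at x also
      -- touches w; no semicontinuous envelope is needed.
      obtain ⟨w, hw, hwx⟩ := hatt x
      change w x = v x at hwx
      simp only
      rw [← hwx]
      refine hw.1.2.2 x _ ⟨φ, hφp, hφ, fun y => ?_, rfl⟩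
      linarith [hmax y, hle w hw y]
    · obtain ⟨w, hw, hwx⟩ := hatt x
      change w x = v x at hwx
      rw [← hwx]
      exact hw.2 x
  refine ⟨v, hvK, fun x => abs_le.2 ⟨hvS.2 x, discountedSubsolutions_le hM hvS hlam x⟩, hvS.1,
    hvp, hvK.continuous, ?_⟩
  rintro x₀ _ ⟨φ, hφp, hφ, hmin, rfl⟩
  by_contra! hneg
  -- Bump argument: where the supersolution property fails, the test function, bent down by `pen`
  -- and raised by δ, is still a subsolution wherever it exceeds v. Its maximum with v would be a
  -- subsolution larger than v at x₀.
  set Q : E N → ℝ := fun y => lam * (φ y + (v x₀ - φ x₀)) +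
    H y (gradient φ y + (-1 : ℝ) • penGrad (y - x₀)) with hQ
  have hQp : ZPeriodic Q := fun y z => by
    have h1 := penGrad_periodic.comp_sub_right x₀ y z
    simp only at h1
    simp only [hQ, hφp y z, gradient_periodic hφp y z, h1, hHp y z]
  have hQc : Continuous Q := by
    have h1 := continuous_gradient hφ
    have h2 := hφ.continuous
    have h3 := continuous_penGrad (N := N)
    have h4 : Continuous fun y => gradient φ y + (-1 : ℝ) • penGrad (y - x₀) := by fun_prop
    exact (continuous_const.mul (h2.add continuous_const)).add
      (hHc.comp (continuous_id.prodMk h4))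
  have hQ0 : Q x₀ < 0 := by
    simp only [hQ, sub_self, penGrad_zero, smul_zero, add_zero, add_sub_cancel]
    exact hneg
  obtain ⟨δ₀, hδ₀, hδQ⟩ := exists_forall_lt_of_pen_lt hQp hQc (show Q x₀ < Q x₀ / 2 by linarith)
  -- The raised function exceeds v only where pen < δ; δ ≤ δ₀ gives Q < Q x₀ / 2 there, and the
  -- second bound lets the remaining half pay for the extra lam · δ.
  set δ := min δ₀ (-Q x₀ / (2 * lam)) with hδ
  have hδpos : 0 < δ := lt_min hδ₀ (div_pos (by linarith) (by positivity))
  have hδlam : lam * δ ≤ -Q x₀ / 2 := by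
    have := min_le_right δ₀ (-Q x₀ / (2 * lam))
    calc lam * δ ≤ lam * (-Q x₀ / (2 * lam)) := by gcongr
      _ = _ := by field_simp
  set ψ : E N → ℝ := fun y => (φ y + (-1) * pen (y - x₀)) + (v x₀ - φ x₀ + δ) with hψdef
  have hψp : ZPeriodic ψ :=
    (hφp.add ((pen_periodic.comp_sub_right x₀).const_mul (-1))).add fun _ _ => rfl
  have hψd : ContDiff ℝ 1 ψ :=
    (hφ.add (contDiff_const.mul (contDiff_pen_sub x₀))).add contDiff_const
  have hψg : ∀ y, gradient ψ y = gradient φ y + (-1 : ℝ) • penGrad (y - x₀) := fun y => by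
    have := (hasGradientAt_add (hasGradientAt_add (hasGradientAt_of_contDiff hφ y)
      (gradient_smul_pen_sub (-1) x₀ y)) (hasGradientAt_const y (v x₀ - φ x₀ + δ))).gradient
    rwa [add_zero] at this
  have hwS := max_mem_discountedSubsolutions hvS hlam hψp hψd fun y hy => by
    have h1 := hmin y
    simp only [hψdef] at hy
    have h2 := hδQ y (lt_of_lt_of_le (show pen (y - x₀) < δ by linarith) (min_le_left _ _))
    simp only [hQ] at h2
    rw [hψg]
    have h3 := mul_nonneg hlam.le (pen_nonneg (y - x₀))
    simp only [hψdef]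
    simp only [hQ] at hδlam
    linarith
  have h1 := hle _ hwS x₀
  have h2 : ψ x₀ = v x₀ + δ := by simp only [hψdef, sub_self, pen_zero]; ring
  have h3 := (le_max_right (v x₀) (ψ x₀)).trans h1
  linarith

end Perron

/-! ### Vanishing discount. -/

lemma superdifferential_sub_const (u : E N → ℝ) (c : ℝ) (x : E N) :
    superdifferential (fun y => u y - c) x = superdifferential u x := by
  ext p
  simp only [superdifferential]
  refine exists_congr fun φ => and_congr_right fun _ => and_congr_right fun _ =>
    and_congr_left fun _ => forall_congr' fun y => ?_
  constructor <;> intro h <;> linarith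

lemma subdifferential_sub_const (u : E N → ℝ) (c : ℝ) (x : E N) :
    subdifferential (fun y => u y - c) x = subdifferential u x := by
  ext p
  simp only [subdifferential]
  refine exists_congr fun φ => and_congr_right fun _ => and_congr_right fun _ =>
    and_congr_left fun _ => forall_congr' fun y => ?_
  constructor <;> intro h <;> linarith

lemma IsViscositySolution.sub_const {F : E N → E N → ℝ} {u : E N → ℝ}
    (hu : IsViscositySolution F u) (c : ℝ) : IsViscositySolution F fun y => u y - c := by
  refine ⟨⟨hu.1.1.sub fun _ _ => rfl, hu.1.2.1.sub continuous_const, fun x p hp => ?_⟩,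
    hu.1.1.sub fun _ _ => rfl, hu.1.2.1.sub continuous_const, fun x p hp => ?_⟩
  · rw [superdifferential_sub_const] at hp
    exact hu.1.2.2 x p hp
  · rw [subdifferential_sub_const] at hp
    exact hu.2.2.2 x p hp

/-- The cell problem of a coercive continuous Hamiltonian is solvable (vanishing discount). -/
lemma exists_isCellSolution {H : E N → E N → ℝ} (hHp : ZPeriodic H)
    (hHc : Continuous fun q : E N × E N => H q.1 q.2) (hco : Coercive H) (P : E N) :
    ∃ u a, IsCellSolution H P u a := by
  set F : E N → E N → ℝ := fun x p => H x (p + P) with hFdef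
  have hFp : ZPeriodic F := fun x z => by simp only [hFdef, hHp x z]
  have hFc : Continuous fun q : E N × E N => F q.1 q.2 :=
    hHc.comp (continuous_fst.prodMk (continuous_snd.add continuous_const))
  obtain ⟨M, -, hM⟩ := ZPeriodic.exists_abs_le (f := fun x => F x 0)
    (fun x z => by simp only [hFp x z]) (hFc.comp (continuous_id.prodMk continuous_const))
  obtain ⟨r, hr⟩ := hco (M + 1)
  set K : ℝ≥0 := (r + ‖P‖).toNNReal
  have hK : ∀ x p, F x p ≤ M → ‖p‖ ≤ K := fun x p hp => by
    have h1 : ‖p + P‖ < r := by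
      by_contra! h
      have := hr x (p + P) h
      simp only [hFdef] at hp
      linarith
    have h2 := norm_sub_le (p + P) P
    rw [add_sub_cancel_right] at h2
    exact le_trans (by linarith) (Real.le_coe_toNNReal _)
  have hlam : ∀ k : ℕ, (0 : ℝ) < 1 / (k + 1) := fun k => by positivity
  choose v hvK hvM hv using fun k : ℕ => exists_discounted_solution hFp hFc hM hK (hlam k)
  let l : Ultrafilter ℕ := hyperfilter ℕ
  have hl : (l : Filter ℕ) ≤ atTop := Nat.hyperfilter_le_atTop
  have hlim : ∀ x, ∃ a ∈ Set.Icc (-(K * ‖x‖)) (K * ‖x‖),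
      Tendsto (fun k => v k x - v k 0) l (𝓝 a) := fun x =>
    exists_ultrafilter_tendsto isCompact_Icc l (Eventually.of_forall fun k => by
      have := (hvK k).dist_le_mul x 0
      rw [Real.dist_eq, dist_zero_right] at this
      exact abs_le.1 this)
  choose u hu hulim using hlim
  obtain ⟨c, -, hc⟩ := exists_ultrafilter_tendsto (isCompact_Icc (a := -M) (b := M)) l
    (Eventually.of_forall fun k => abs_le.1 (hvM k 0))
  have hup : ZPeriodic u := fun x z => tendsto_nhds_unique (hulim _)
    ((hulim x).congr fun k => by rw [← (hv k).1.1.add_intVec x z]; rfl)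
  have hGp : ZPeriodic fun x p => F x p - -c := fun x z => by simp only [hFp x z]
  have hwK : ∀ k, LipschitzWith K fun x => v k x - v k 0 := fun k =>
    LipschitzWith.of_dist_le_mul fun x y => by
      rw [dist_sub_right]
      exact (hvK k).dist_le_mul x y
  have hF : ∀ (x : ℕ → E N) (p : ℕ → E N) (ξ q : E N), Tendsto x l (𝓝 ξ) → Tendsto p l (𝓝 q) →
      Tendsto (fun k : ℕ => 1 / ((k : ℝ) + 1) * v k (x k) + F (x k) (p k)) l
        (𝓝 (F ξ q - -c)) := by
    intro x p ξ q hx hp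
    -- By the uniform Lipschitz bound the oscillation of v k, multiplied by the discount, vanishes:
    -- the zeroth-order term tends to the constant c, and -c becomes the cell level.
    have h1 : Tendsto (fun k : ℕ => 1 / ((k : ℝ) + 1) * (v k (x k) - v k 0)) l (𝓝 0) := by
      refine squeeze_zero_norm (fun k => ?_)
        (a := fun k : ℕ => 1 / ((k : ℝ) + 1) * (K * ‖x k‖)) ?_
      · rw [norm_mul, Real.norm_of_nonneg (hlam k).le, ← dist_eq_norm]
        have := (hvK k).dist_le_mul (x k) 0
        rw [dist_zero_right] at this
        gcongr
      · simpa using (tendsto_one_div_add_atTop_nhds_zero_nat.mono_left hl).mul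
          (hx.norm.const_mul (K : ℝ))
    have h2 := ((hFc.tendsto (ξ, q)).comp (hx.prodMk_nhds hp)).add (h1.add hc)
    rw [zero_add, ← sub_neg_eq_add] at h2
    refine h2.congr fun k => ?_
    simp only [Function.comp]
    ring
  have hsub := IsViscositySubsolution.of_tendsto hwK hup hGp
    (fun k => ((hv k).sub_const (v k 0)).1) hulim hF
  have hsup := IsViscositySupersolution.of_tendsto hwK hup hGp
    (fun k => ((hv k).sub_const (v k 0)).2) hulim hF
  exact ⟨u, -c, ⟨K, hsub.1⟩, hsub.2, hsup⟩

/-! ### Subsolution levels and generalized effective Hamiltonians. -/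

/-- The levels `a` at which `H(x, Du + P) ≤ a` has a Lipschitz viscosity subsolution. -/
def subsolutionLevels (H : E N → E N → ℝ) (P : E N) : Set ℝ :=
  {a | ∃ u, (∃ K : ℝ≥0, LipschitzWith K u) ∧
    IsViscositySubsolution (fun x p => H x (p + P) - a) u}

/-- The infimum of the levels which admit a Lipschitz subsolution. -/
noncomputable def effectiveInf (H : E N → E N → ℝ) (P : E N) : ℝ := sInf (subsolutionLevels H P)

lemma IsViscositySubsolution.of_le {F G : E N → E N → ℝ} {u : E N → ℝ}
    (hu : IsViscositySubsolution F u) (h : ∀ x, ∀ p ∈ superdifferential u x, G x p ≤ F x p) :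
    IsViscositySubsolution G u :=
  ⟨hu.1, hu.2.1, fun x p hp => (h x p hp).trans (hu.2.2 x p hp)⟩

section

variable {H : E N → E N → ℝ} {P : E N}

lemma IsCellSolution.mem_subsolutionLevels {u : E N → ℝ} {a : ℝ} (hu : IsCellSolution H P u a) :
    a ∈ subsolutionLevels H P :=
  ⟨u, hu.1, hu.2.1⟩

lemma IsCellSolution.le_of_mem_subsolutionLevels (hHp : ZPeriodic H)
    (hHc : Continuous fun q : E N × E N => H q.1 q.2) {v : E N → ℝ} {a b : ℝ}
    (hv : IsCellSolution H P v b) (ha : a ∈ subsolutionLevels H P) : b ≤ a := by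
  obtain ⟨u, ⟨K, hK⟩, hu⟩ := ha
  exact comparison (H := fun x p => H x (p + P)) (fun x z => by simp only [hHp x z])
    (hHc.comp (continuous_fst.prodMk (continuous_snd.add continuous_const))) hK hu hv.2.2

lemma IsCellSolution.effectiveInf_eq (hHp : ZPeriodic H)
    (hHc : Continuous fun q : E N × E N => H q.1 q.2) {u : E N → ℝ} {a : ℝ}
    (hu : IsCellSolution H P u a) : effectiveInf H P = a :=
  IsLeast.csInf_eq ⟨hu.mem_subsolutionLevels, fun _ hb => hu.le_of_mem_subsolutionLevels hHp hHc hb⟩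

lemma IsCellSolution.isCriticalValue (hHp : ZPeriodic H)
    (hHc : Continuous fun q : E N × E N => H q.1 q.2) {u : E N → ℝ} {a : ℝ}
    (hu : IsCellSolution H P u a) : IsCriticalValue H P a := by
  refine ⟨⟨u, hu⟩, ?_⟩
  rintro b ⟨v, hv⟩
  rw [← hu.effectiveInf_eq hHp hHc, hv.effectiveInf_eq hHp hHc]

lemma bddBelow_subsolutionLevels (h0 : ∀ x p, 0 ≤ H x p) : BddBelow (subsolutionLevels H P) := by
  refine ⟨0, ?_⟩
  rintro a ⟨u, -, hu⟩
  obtain ⟨x, hx, -⟩ := exists_zero_mem_superdifferential hu.1 hu.2.1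
  have := hu.2.2 x 0 hx
  have := h0 x (0 + P)
  linarith

lemma subsolutionLevels_nonempty {B : ℝ} (hB : ∀ x p, H x p ≤ B) :
    (subsolutionLevels H P).Nonempty :=
  ⟨B, fun _ => 0, ⟨0, LipschitzWith.const 0⟩, fun _ _ => rfl, continuous_const,
    fun _ _ _ => sub_nonpos.2 (hB _ _)⟩

/-- One and the same u serves for P and Q, with its level raised by C ‖P - Q‖. -/
lemma effectiveInf_le_add {B C : ℝ} (h0 : ∀ x p, 0 ≤ H x p) (hB : ∀ x p, H x p ≤ B)
    (hC : ∀ x p q, H x p ≤ H x q + C * ‖p - q‖) (P Q : E N) :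
    effectiveInf H P ≤ effectiveInf H Q + C * ‖P - Q‖ := by
  rw [← sub_le_iff_le_add]
  refine le_csInf (subsolutionLevels_nonempty hB) ?_
  rintro a ⟨u, hK, hu⟩
  rw [sub_le_iff_le_add]
  refine csInf_le (bddBelow_subsolutionLevels h0) ⟨u, hK, hu.of_le fun x p _ => ?_⟩
  have := hC x (p + P) (p + Q)
  rw [add_sub_add_left_eq_sub] at this
  linarith

/-- For a bounded Hamiltonian, Lipschitz in the gradient variable, the infimum of subsolution
levels is a generalized effective Hamiltonian. -/
lemma isGeneralizedEffectiveHamiltonian_effectiveInf {B C : ℝ} (h0 : ∀ x p, 0 ≤ H x p)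
    (hB : ∀ x p, H x p ≤ B) (hC0 : 0 ≤ C) (hC : ∀ x p q, H x p ≤ H x q + C * ‖p - q‖) :
    IsGeneralizedEffectiveHamiltonian H (effectiveInf H) := by
  intro Hn Hbar happ heff
  refine ⟨fun R _ ε hε => ?_, fun ε hε => ?_⟩
  · suffices h : ∀ᶠ n in atTop, ∀ P ∈ Metric.closedBall (0 : E N) R,
        -ε ≤ effectiveInf H P - Hbar n P by
      filter_upwards [h] with n hn P hP
      exact hn P (by simpa using hP)
    -- Uniformity over the ball comes from a finite cover: near Q, a single nearly optimal Lipschitz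
    -- subsolution serves all P. The error ε splits into four quarters: near-optimality, replacing Q
    -- by P in the subsolution, replacing H by Hₙ, and the variation of `effectiveInf H`.
    refine (isCompact_closedBall (0 : E N) R).induction_on
      (p := fun s => ∀ᶠ n in atTop, ∀ P ∈ s, -ε ≤ effectiveInf H P - Hbar n P)
      (by simp) (fun s t hst ht => ht.mono fun n hn P hP => hn P (hst hP))
      (fun s t hs ht => ?_) (fun Q _ => ?_)
    · filter_upwards [hs, ht] with n hn hn' P hP
      exact hP.elim (hn P) (hn' P)
    · obtain ⟨a, ⟨u, ⟨K, hK⟩, hu⟩, ha⟩ := exists_lt_of_csInf_lt (subsolutionLevels_nonempty hB)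
        (show sInf (subsolutionLevels H Q) < effectiveInf H Q + ε / 4 by
          rw [← effectiveInf]; linarith)
      set δ := ε / (4 * (C + 1)) with hδ
      have hδ0 : 0 < δ := by positivity
      have hCδ : C * δ ≤ ε / 4 := by
        have : (C + 1) * δ = ε / 4 := by rw [hδ]; field_simp
        linarith
      refine ⟨Metric.ball Q δ, mem_nhdsWithin_of_mem_nhds (Metric.ball_mem_nhds Q hδ0), ?_⟩
      filter_upwards [happ.liminf_nonneg (K + (‖Q‖ + δ)) (by positivity) (ε / 4) (by positivity)]
        with n hn P hP
      rw [Metric.mem_ball, dist_eq_norm] at hP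
      have hPQ : C * ‖P - Q‖ ≤ ε / 4 := le_trans (by gcongr) hCδ
      have hlev : a + ε / 2 ∈ subsolutionLevels (Hn n) P := by
        refine ⟨u, ⟨K, hK⟩, hu.of_le fun x p hp => ?_⟩
        have h1 := norm_le_of_mem_superdifferential hK hp
        have h2 : ‖p + P‖ ≤ K + (‖Q‖ + δ) := by
          have h3 := norm_add_le Q (P - Q)
          rw [add_sub_cancel] at h3
          exact (norm_add_le _ _).trans (by linarith)
        have h3 := hn x (p + P) h2
        have h4 := hC x (p + P) (p + Q)
        rw [add_sub_add_left_eq_sub] at h4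
        linarith
      obtain ⟨v, hv⟩ := (heff n P).1
      have h1 := hv.le_of_mem_subsolutionLevels (happ.periodic n) (happ.continuous n) hlev
      have h2 := effectiveInf_le_add h0 hB hC Q P
      rw [norm_sub_rev] at h2
      linarith
  -- Here the cell solution for Hₙ has no Lipschitz bound uniform in n and P; the bound H ≤ Hₙ + ε
  -- is needed for all p at once.
  · filter_upwards [happ.limsup_nonpos ε hε] with n hn P
    obtain ⟨v, hK, hv, -⟩ := (heff n P).1
    have : effectiveInf H P ≤ Hbar n P + ε := by
      refine csInf_le (bddBelow_subsolutionLevels h0) ⟨v, hK, hv.of_le fun x p _ => ?_⟩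
      have := hn x (p + P)
      linarith
    linarith

/-- Source of uniqueness: any single admissible sequence determines the value at P as a limit. -/
lemma IsGeneralizedEffectiveHamiltonian.tendsto {G : E N → ℝ} {Hn : ℕ → E N → E N → ℝ}
    {Hbar : ℕ → E N → ℝ} (hG : IsGeneralizedEffectiveHamiltonian H G)
    (happ : IsApproximation H Hn) (heff : ∀ n, IsEffectiveHamiltonian (Hn n) (Hbar n)) (P : E N) :
    Tendsto (fun n => Hbar n P) atTop (𝓝 (G P)) := by
  obtain ⟨h1, h2⟩ := hG Hn Hbar happ heff
  rw [Metric.tendsto_nhds]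
  intro ε hε
  filter_upwards [h1 (‖P‖ + 1) (by positivity) (ε / 2) (by positivity),
    h2 (ε / 2) (by positivity)] with n hn hn'
  have := hn P (by linarith)
  have := hn' P
  rw [Real.dist_eq, abs_lt]
  constructor <;> linarith

/-- The coercive approximations `H(x, p) + (|p| - n)₊` of `H`. -/
noncomputable def coerciveApprox (H : E N → E N → ℝ) (n : ℕ) (x p : E N) : ℝ :=
  H x p + max (‖p‖ - n) 0

lemma le_coerciveApprox (n : ℕ) (x p : E N) : H x p ≤ coerciveApprox H n x p :=
  le_add_of_nonneg_right (le_max_right _ _)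

lemma coerciveApprox_of_norm_le {n : ℕ} (x : E N) {p : E N} (hp : ‖p‖ ≤ n) :
    coerciveApprox H n x p = H x p := by
  rw [coerciveApprox, max_eq_right (by linarith), add_zero]

lemma isApproximation_coerciveApprox (hHp : ZPeriodic H)
    (hHc : Continuous fun q : E N × E N => H q.1 q.2) (h0 : ∀ x p, 0 ≤ H x p) :
    IsApproximation H (coerciveApprox H) where
  periodic n x z := by ext p; simp only [coerciveApprox, hHp x z]
  continuous n := hHc.add (by fun_prop)
  coercive n C := ⟨C + n, fun x p hp => by
    have := le_max_left (‖p‖ - n) 0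
    have := h0 x p
    simp only [coerciveApprox]
    linarith⟩
  liminf_nonneg R _ ε hε := by
    filter_upwards [eventually_ge_atTop ⌈R⌉₊] with n hn x p hp
    rw [coerciveApprox_of_norm_le x (hp.trans (Nat.ceil_le.1 hn))]
    linarith
  limsup_nonpos ε hε := Eventually.of_forall fun n x p => by
    have := le_coerciveApprox (H := H) n x p
    linarith

end

/-! ### The Hamiltonian σ(x) m(|p|). -/

section Hamiltonian

variable {σ : E N → ℝ} {m : ℝ≥0 → ℝ}

lemma hamiltonian_periodic (hσ : ZPeriodic σ) : ZPeriodic (hamiltonian σ m) := fun x z => by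
  ext p; simp only [hamiltonian, hσ x z]

lemma continuous_hamiltonian (hσ : Continuous σ) (hm : Continuous m) :
    Continuous fun q : E N × E N => hamiltonian σ m q.1 q.2 :=
  (hσ.comp continuous_fst).mul (hm.comp continuous_snd.nnnorm)

lemma hamiltonian_le_add {L : ℝ≥0} {B : ℝ} (hσ : ∀ x, 0 < σ x) (hB : ∀ x, σ x ≤ B)
    (hm : LipschitzWith L m) (x p q : E N) :
    hamiltonian σ m x p ≤ hamiltonian σ m x q + B * L * ‖p - q‖ := by
  have h1 := (le_abs_self _).trans (hm.dist_le_mul ‖p‖₊ ‖q‖₊)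
  have h2 : dist ‖p‖₊ ‖q‖₊ ≤ ‖p - q‖ := by
    rw [NNReal.dist_eq]; exact abs_norm_sub_norm_le p q
  have h3 : m ‖p‖₊ - m ‖q‖₊ ≤ L * ‖p - q‖ := h1.trans (by gcongr)
  have h4 : σ x * (m ‖p‖₊ - m ‖q‖₊) ≤ B * (L * ‖p - q‖) :=
    (mul_le_mul_of_nonneg_left h3 (hσ x).le).trans (by gcongr; exact hB x)
  simp only [hamiltonian]
  linarith

/-- A solvable cell problem has its constant below the minimum of `σ`. -/
lemma IsCellSolution.lt_iInf {P : E N} {u : E N → ℝ} {a : ℝ} (hσp : ZPeriodic σ)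
    (hσc : Continuous σ) (hσ : ∀ x, 0 < σ x) (hm : ∀ r, m r ∈ Set.Ioo (0 : ℝ) 1)
    (hmono : StrictMono m) (hu : IsCellSolution (hamiltonian σ m) P u a) : a < ⨅ x, σ x := by
  obtain ⟨⟨K, hK⟩, -, hup, huc, hu⟩ := hu
  obtain ⟨x₀, -, hx₀⟩ := hσp.neg.exists_max hσc.neg
  refine lt_of_lt_of_le ?_ (le_ciInf fun x => neg_le_neg_iff.1 (hx₀ x))
  obtain ⟨hμ0, hμ1⟩ := hm (K + ‖P‖₊)
  set μ := m (K + ‖P‖₊)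
  have hs := hσ x₀
  -- The number μ < 1 bounds m(|p + P|) for all subgradients p. The tolerance σ x₀ (1 - μ) works
  -- because (2 - μ) μ = 1 - (1 - μ)² ≤ 1.
  obtain ⟨x, p, hp, hx⟩ := exists_mem_subdifferential_lt hup huc hσp hσc x₀
    (show 0 < σ x₀ * (1 - μ) from mul_pos hs (by linarith))
  have h1 := hu x p hp
  have h2 : m ‖p + P‖₊ ≤ μ := hmono.monotone ((nnnorm_add_le p P).trans (by
    gcongr; exact norm_le_of_mem_subdifferential hK hp))
  have h3 : σ x * m ‖p + P‖₊ ≤ σ x * μ := mul_le_mul_of_nonneg_left h2 (hσ x).le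
  have h4 : σ x * μ < (σ x₀ + σ x₀ * (1 - μ)) * μ := by gcongr
  have h5 : (σ x₀ + σ x₀ * (1 - μ)) * μ ≤ σ x₀ := by
    nlinarith [mul_nonneg hs.le (sq_nonneg (1 - μ))]
  simp only [hamiltonian] at h1
  linarith

/-- A cell solution for a coercive approximation, at a sufficiently low level, is one for the
original Hamiltonian. -/
lemma IsCellSolution.of_coerciveApprox {P : E N} {u : E N → ℝ} {a s : ℝ} {n : ℕ}
    (hs : ∀ x, s ≤ σ x) (hm : ∀ r, m r ∈ Set.Ioo (0 : ℝ) 1)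
    (hmono : StrictMono m) (hσ : ∀ x, 0 < σ x) (ha : a ≤ s * m n)
    (hu : IsCellSolution (coerciveApprox (hamiltonian σ m) n) P u a) :
    IsCellSolution (hamiltonian σ m) P u a := by
  refine ⟨hu.1, hu.2.1.of_le fun x p _ => ?_, hu.2.2.1, hu.2.2.2.1, fun x p hp => ?_⟩
  · have := le_coerciveApprox (H := hamiltonian σ m) n x (p + P)
    linarith
  -- For |p + P| ≤ n the two Hamiltonians coincide; beyond n, H alone already reaches s · m n ≥ a.
  · rcases le_total ‖p + P‖ n with h | h
    · have := hu.2.2.2.2 x p hp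
      simpa only [coerciveApprox_of_norm_le x h] using this
    · have h1 : (n : ℝ≥0) ≤ ‖p + P‖₊ := by exact_mod_cast h
      have h2 : s * m n ≤ σ x * m ‖p + P‖₊ :=
        mul_le_mul (hs x) (hmono.monotone h1) (hm _).1.le (hσ x).le
      simp only [hamiltonian]
      linarith

end Hamiltonian

end CellProblem

theorem theorem3p2 (N : ℕ) (σ : CellProblem.E N → ℝ) (m : ℝ≥0 → ℝ)
    (hσ_per : CellProblem.ZPeriodic σ) (hσ_cont : Continuous σ) (hσ_pos : ∀ x, 0 < σ x)
    (hm_range : ∀ r, m r ∈ Set.Ioo (0 : ℝ) 1) (hm_lip : ∃ L : ℝ≥0, LipschitzWith L m)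
    (hm_mono : StrictMono m) (hm_lim : Tendsto m atTop (𝓝 1)) :
    (∃! G : CellProblem.E N → ℝ,
      CellProblem.IsGeneralizedEffectiveHamiltonian (CellProblem.hamiltonian σ m) G) ∧
    ∀ Hinf : CellProblem.E N → ℝ,
      CellProblem.IsGeneralizedEffectiveHamiltonian (CellProblem.hamiltonian σ m) Hinf →
        CellProblem.solvabilitySet (CellProblem.hamiltonian σ m) = {P | Hinf P < ⨅ x, σ x} ∧
        ∀ P ∈ CellProblem.solvabilitySet (CellProblem.hamiltonian σ m),
          CellProblem.IsCriticalValue (CellProblem.hamiltonian σ m) P (Hinf P) := by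
  open CellProblem in
  obtain ⟨L, hL⟩ := hm_lip
  obtain ⟨B, hB0, hB⟩ := hσ_per.exists_abs_le hσ_cont
  have hσB : ∀ x, σ x ≤ B := fun x => (le_abs_self _).trans (hB x)
  have hHp := hamiltonian_periodic (m := m) hσ_per
  have hHc := continuous_hamiltonian hσ_cont hL.continuous
  have hH0 : ∀ x p, 0 ≤ hamiltonian σ m x p := fun x p =>
    mul_nonneg (hσ_pos x).le (hm_range _).1.le
  have hHB : ∀ x p, hamiltonian σ m x p ≤ B := fun x p =>
    (mul_le_of_le_one_right (hσ_pos x).le (hm_range _).2.le).trans (hσB x)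
  have hgen := isGeneralizedEffectiveHamiltonian_effectiveInf hH0 hHB
    (show 0 ≤ B * L by positivity) (hamiltonian_le_add hσ_pos hσB hL)
  have happ := isApproximation_coerciveApprox hHp hHc hH0
  choose u Hbar hu using fun n => exists_isCellSolution (happ.periodic n) (happ.continuous n)
    (happ.coercive n)
  have heff : ∀ n, IsEffectiveHamiltonian (coerciveApprox (hamiltonian σ m) n) (Hbar n) :=
    fun n P => (hu n P).isCriticalValue (happ.periodic n) (happ.continuous n)
  have huniq : ∀ G, IsGeneralizedEffectiveHamiltonian (hamiltonian σ m) G →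
      G = effectiveInf (hamiltonian σ m) := fun G hG => funext fun P =>
    tendsto_nhds_unique (hG.tendsto happ heff P) (hgen.tendsto happ heff P)
  refine ⟨⟨_, hgen, huniq⟩, fun G hG => ?_⟩
  rw [huniq G hG]
  refine ⟨Set.Subset.antisymm ?_ fun P hP => ?_, ?_⟩
  · rintro P ⟨v, c, hv⟩
    rw [Set.mem_ofPred_eq, hv.effectiveInf_eq hHp hHc]
    exact hv.lt_iInf hσ_per hσ_cont hσ_pos hm_range hm_mono
  -- The approximate levels tend to a limit below inf σ, while inf σ · m n tends to inf σ; some n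
  -- therefore satisfies the level condition of `IsCellSolution.of_coerciveApprox`.
  · have hlim : Tendsto (fun n : ℕ => (⨅ x, σ x) * m n) atTop (𝓝 ((⨅ x, σ x) * 1)) :=
      (hm_lim.comp tendsto_natCast_atTop_atTop).const_mul _
    rw [mul_one] at hlim
    obtain ⟨n, hn⟩ := ((hgen.tendsto happ heff P).eventually_lt hlim hP).exists
    exact ⟨u n P, Hbar n P, (hu n P).of_coerciveApprox
      (fun x => ciInf_le ⟨0, by rintro _ ⟨y, rfl⟩; exact (hσ_pos y).le⟩ x)
      hm_range hm_mono hσ_pos hn.le⟩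
  · rintro P ⟨v, c, hv⟩
    rw [hv.effectiveInf_eq hHp hHc]
    exact hv.isCriticalValue hHp hHc
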